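/- Let $R$ be a commutative noetherian local ring with maximal ideal $\mathfrak m$, residue field $k$ and $\mathfrak m$-adic completion $\widehat R$. An $R$-module $M$ is \emph{mini-max} if it has a noetherian submodule $N$ such that $M/N$ is artinian. A module $L$ over a local ring $S$ is \emph{Matlis reflexive} if the biduality map $L\to\operatorname{Hom}_S(\operatorname{Hom}_S(L,E),E)$, $x\mapsto(\psi\mapsto\psi(x))$, is an isomorphism, where $E$ is the injective hull of the residue field of $S$. Let $M$ and $M'$ be $R$-modules such that $M$ is mini-max and $M'$ is Matlis reflexive (over $R$). Then for every $i\ge 0$ the $R$-module $\operatorname{Tor}_i^R(M,M')$ is Matlis reflexive over $R$; moreover it has a unique $\widehat R$-module structure that extends its $R$-module structure, and with this structure it is Matlis reflexive over $\widehat R$. -/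

import Mathlib

universe u

section MatlisReflexive

/-- `f : K → E` exhibits the `R`-module `E` as an injective hull of `K`: the module `E` is
injective, `f` is a monomorphism, and `E` is an essential extension of the image of `f`, that is,
every nonzero submodule of `E` meets this image nontrivially. -/
structure IsInjectiveHull {R : Type u} [CommRing R] {K E : Type u} [AddCommGroup K] [Module R K]
    [AddCommGroup E] [Module R E] (f : K →ₗ[R] E) : Prop where
  injective_module : Module.Injective R E
  injective_map : Function.Injective f
  essential : ∀ N : Submodule R E, N ⊓ LinearMap.range f = ⊥ → N = ⊥

/-- The natural biduality map `M → Hom_R(Hom_R(M, E), E)`, `x ↦ (ψ ↦ ψ x)`. -/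
def bidualityMap (R : Type u) [CommRing R] (M E : Type u) [AddCommGroup M] [Module R M]
    [AddCommGroup E] [Module R E] : M →ₗ[R] ((M →ₗ[R] E) →ₗ[R] E) where
  toFun x :=
    { toFun := fun ψ => ψ x
      map_add' := fun _ _ => rfl
      map_smul' := fun _ _ => rfl }
  map_add' x y := by
    ext ψ
    exact map_add ψ x y
  map_smul' r x := by
    ext ψ
    exact map_smul ψ r x

/-- A module `M` over a local ring `R` with residue field `k` is Matlis reflexive if the
biduality map `M → Hom_R(Hom_R(M, E), E)` is an isomorphism, where `E` is the injective hull of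
`k`. As an injective hull is unique up to isomorphism, it does not matter which one is taken. -/
def IsMatlisReflexive (R : Type u) [CommRing R] [IsLocalRing R] (M : Type u) [AddCommGroup M]
    [Module R M] : Prop :=
  ∃ (E : Type u) (_ : AddCommGroup E) (_ : Module R E)
    (f : IsLocalRing.ResidueField R →ₗ[R] E),
    IsInjectiveHull f ∧ Function.Bijective (bidualityMap R M E)

/-- A module is mini-max if it has a noetherian submodule with artinian quotient. -/
def IsMiniMax (R : Type u) [CommRing R] (M : Type u) [AddCommGroup M] [Module R M] : Prop :=
  ∃ N : Submodule R M, IsNoetherian R N ∧ IsArtinian R (M ⧸ N)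

/-- The completion of a local ring with respect to its maximal ideal. -/
abbrev LocalCompletion (R : Type u) [CommRing R] [IsLocalRing R] : Type u :=
  AdicCompletion (IsLocalRing.maximalIdeal R) R

/-- The `R`-module `L` is Matlis reflexive over the completion of `R`: it has exactly one module
structure over the completion which extends its `R`-module structure, and with this structure it
is Matlis reflexive. -/
def IsMatlisReflexiveOverCompletion (R : Type u) [CommRing R] [IsLocalRing R]
    [IsNoetherianRing R] (L : Type u) [AddCommGroup L] [Module R L] : Prop :=
  ∃ inst : Module (LocalCompletion R) L,
    IsScalarTower R (LocalCompletion R) L ∧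
    (∀ inst' : Module (LocalCompletion R) L,
      (letI := inst'; IsScalarTower R (LocalCompletion R) L) → inst' = inst) ∧
    IsMatlisReflexive (LocalCompletion R) L

/-- The `R`-module `Tor_i^R(M, M')`. -/
noncomputable abbrev TorModule (R : Type u) [CommRing R] (i : ℕ) (M M' : Type u)
    [AddCommGroup M] [Module R M] [AddCommGroup M'] [Module R M'] : ModuleCat.{u} R :=
  ((CategoryTheory.Tor (ModuleCat.{u} R) i).obj (ModuleCat.of R M)).obj (ModuleCat.of R M')

end MatlisReflexive

/-! Fix an injective hull `E` of the residue field and write `X*` for `Hom(X, E)`. Since `E` is an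
injective cogenerator, reflexivity passes to submodules, quotients and extensions. For finite `M`,
`Tor_0` is a quotient of a power of `M'`, and dimension shifting along a finite free cover embeds
`Tor_{i+1}(M, M')` in some `Tor_i`.

The artinian case rests on an ideal `I` that kills `M'` and has `R/I` reflexive
(`exists_refl_quotient_ideal`). It exists because a reflexive `X` has a finite submodule `N` with
`X/N` torsion for the maximal ideal: otherwise some quotient of `X` would have infinite-dimensional
socle, which reflexivity forbids. The annihilators of `N` and of the finite module `(X/N)*` then
provide `I`. A torsion module killed by `I` is reflexive as soon as its socle is, for it embeds in a
finite power of `(R/I)*` (`refl_of_isMaxTorsion`). For artinian `A`, the socle of `Tor_i(A, M')`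
lies in the kernel of multiplication by any `x` in the maximal ideal. That kernel is controlled by
Tor of the kernel and cokernel of `x` on `A`, so induction on generators of the maximal ideal
reduces to modules killed by it.

Finally `Tor` is killed by `I`, and reflexivity makes `R/I` complete. Thus `R/I` is a quotient of
the completion by an ideal inside the extension of `I`. This gives the module structure and its
uniqueness, and reflexivity is carried across the common quotient ring. -/

namespace MatlisDuality

/-! ### Injective hulls of the residue field, marked by a socle generator -/

section Basics

variable {R : Type u} [CommRing R] {E : Type u} [AddCommGroup E] [Module R E]

/-- The biduality map of `L` with respect to `E` is bijective. -/
def Refl (R : Type u) [CommRing R] (E : Type u) [AddCommGroup E] [Module R E] (L : Type u)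
    [AddCommGroup L] [Module R L] : Prop :=
  Function.Bijective (bidualityMap R L E)

/-- `E` is injective and an essential extension of the simple module generated by `e`. -/
structure IsSimpleHull (R : Type u) [CommRing R] [IsLocalRing R] (E : Type u) [AddCommGroup E]
    [Module R E] (e : E) : Prop where
  inj : Module.Injective R E
  ne_zero : e ≠ 0
  smul_eq_zero : ∀ r ∈ IsLocalRing.maximalIdeal R, r • e = 0
  ess : ∀ x : E, x ≠ 0 → ∃ r : R, r • x = e

theorem exists_extend [inj : Module.Injective R E] {X Y : Type u} [AddCommGroup X] [Module R X]
    [AddCommGroup Y] [Module R Y] (f : X →ₗ[R] Y) (hf : Function.Injective f) (g : X →ₗ[R] E) :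
    ∃ h : Y →ₗ[R] E, ∀ x, h (f x) = g x :=
  inj.out f hf g

variable {X Y Z : Type u} [AddCommGroup X] [Module R X] [AddCommGroup Y] [Module R Y]
  [AddCommGroup Z] [Module R Z]

theorem isSimpleHull_of_isInjectiveHull [IsLocalRing R]
    {f : IsLocalRing.ResidueField R →ₗ[R] E} (hf : IsInjectiveHull f) :
    IsSimpleHull R E (f 1) where
  inj := hf.injective_module
  ne_zero h := one_ne_zero (hf.injective_map (h.trans (map_zero f).symm))
  smul_eq_zero r hr := by
    rw [← map_smul, Algebra.smul_def, mul_one, IsLocalRing.ResidueField.algebraMap_eq,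
      (IsLocalRing.residue_eq_zero_iff r).2 hr, map_zero]
  ess x hx := by
    by_contra! hne
    refine hx ?_
    have : R ∙ x = ⊥ := hf.essential _ ?_
    · simpa using this
    rw [eq_bot_iff]
    rintro y ⟨hy, c, rfl⟩
    obtain ⟨r, hr⟩ := Submodule.mem_span_singleton.1 hy
    by_contra hc
    have hc0 : c ≠ 0 := by rintro rfl; exact hc (by simp)
    obtain ⟨s, hs⟩ := IsLocalRing.residue_surjective (c⁻¹)
    refine hne (s * r) ?_
    rw [mul_smul, hr, ← map_smul, Algebra.smul_def, IsLocalRing.ResidueField.algebraMap_eq, hs,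
      inv_mul_cancel₀ hc0]

theorem IsSimpleHull.exists_isInjectiveHull [IsLocalRing R] {e : E} (h : IsSimpleHull R E e) :
    ∃ f : IsLocalRing.ResidueField R →ₗ[R] E, IsInjectiveHull f ∧ f 1 = e := by
  let f : IsLocalRing.ResidueField R →ₗ[R] E :=
    Submodule.liftQ (IsLocalRing.maximalIdeal R) (LinearMap.toSpanSingleton R E e)
      (fun r hr => by simpa using h.smul_eq_zero r hr)
  have hf (r : R) : f (IsLocalRing.residue R r) = r • e := rfl
  have f1 : f 1 = e := by rw [← map_one (IsLocalRing.residue R), hf, one_smul]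
  refine ⟨f, ⟨h.inj, ?_, ?_⟩, f1⟩
  · rw [injective_iff_map_eq_zero]
    intro a ha
    obtain ⟨r, rfl⟩ := IsLocalRing.residue_surjective a
    rw [hf] at ha
    rw [IsLocalRing.residue_eq_zero_iff]
    intro hu
    obtain ⟨u, rfl⟩ := hu
    exact h.ne_zero (by simpa using congrArg (fun y => (↑u⁻¹ : R) • y) ha)
  · intro N hN
    rw [eq_bot_iff]
    intro x hx
    by_contra hx0
    obtain ⟨r, hr⟩ := h.ess x hx0
    have : e ∈ N ⊓ LinearMap.range f := ⟨hr ▸ N.smul_mem r hx, 1, f1⟩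
    rw [hN] at this
    exact h.ne_zero this

theorem isMatlisReflexive_iff [IsLocalRing R] (L : Type u) [AddCommGroup L] [Module R L] :
    IsMatlisReflexive R L ↔ ∃ (E : Type u) (_ : AddCommGroup E) (_ : Module R E) (e : E),
      IsSimpleHull R E e ∧ Refl R E L := by
  constructor
  · rintro ⟨E, _, _, f, hf, h⟩
    exact ⟨E, _, _, f 1, isSimpleHull_of_isInjectiveHull hf, h⟩
  · rintro ⟨E, _, _, e, he, h⟩
    obtain ⟨f, hf, -⟩ := he.exists_isInjectiveHull
    exact ⟨E, _, _, f, hf, h⟩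

end Basics

/-! ### Separation by functionals and closure properties of reflexivity -/

section Hull

variable {R : Type u} [CommRing R] [IsLocalRing R] {E : Type u} [AddCommGroup E] [Module R E]
  {e : E}
variable {X Y Z : Type u} [AddCommGroup X] [Module R X] [AddCommGroup Y] [Module R Y]
  [AddCommGroup Z] [Module R Z]

/-- The annihilator of `x` is proper, hence kills `e`; so `x ↦ e` is well defined on `Rx` and
extends by injectivity. -/
theorem IsSimpleHull.exists_apply_ne_zero (h : IsSimpleHull R E e) (x : X) (hx : x ≠ 0) :
    ∃ ψ : X →ₗ[R] E, ψ x ≠ 0 := by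
  have := h.inj
  have hle : LinearMap.ker (LinearMap.toSpanSingleton R X x) ≤
      LinearMap.ker (LinearMap.toSpanSingleton R E e) := by
    intro r hr
    refine h.smul_eq_zero r fun hu => hx ?_
    obtain ⟨u, rfl⟩ := hu
    have hr' : (u : R) • x = 0 := hr
    simpa using congrArg (fun y => (↑u⁻¹ : R) • y) hr'
  obtain ⟨ψ, hψ⟩ := exists_extend (E := E)
    ((LinearMap.ker (LinearMap.toSpanSingleton R X x)).liftQ (LinearMap.toSpanSingleton R X x) le_rfl)
    (by
      rw [← LinearMap.ker_eq_bot]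
      exact Submodule.ker_liftQ_eq_bot _ _ _ le_rfl)
    ((LinearMap.ker (LinearMap.toSpanSingleton R X x)).liftQ (LinearMap.toSpanSingleton R E e) hle)
  refine ⟨ψ, ?_⟩
  have := hψ (Submodule.Quotient.mk 1)
  simp only [Submodule.liftQ_apply, LinearMap.toSpanSingleton_apply, one_smul] at this
  rw [this]
  exact h.ne_zero

theorem IsSimpleHull.eq_of_apply_eq (h : IsSimpleHull R E e) {x y : X}
    (hxy : ∀ ψ : X →ₗ[R] E, ψ x = ψ y) : x = y := by
  by_contra hne
  obtain ⟨ψ, hψ⟩ := h.exists_apply_ne_zero (x - y) (sub_ne_zero.2 hne)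
  exact hψ (by rw [map_sub, hxy, sub_self])

theorem IsSimpleHull.mem_of_apply_eq_zero (h : IsSimpleHull R E e) (N : Submodule R X) {x : X}
    (hx : ∀ ψ : X →ₗ[R] E, (∀ y ∈ N, ψ y = 0) → ψ x = 0) : x ∈ N := by
  rw [← Submodule.Quotient.mk_eq_zero]
  refine h.eq_of_apply_eq fun ψ => ?_
  rw [map_zero]
  exact hx (ψ ∘ₗ N.mkQ) fun y hy => by
    simp [(Submodule.Quotient.mk_eq_zero N).2 hy]

theorem IsSimpleHull.refl_iff (h : IsSimpleHull R E e) :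
    Refl R E X ↔ ∀ φ : (X →ₗ[R] E) →ₗ[R] E, ∃ x, ∀ ψ : X →ₗ[R] E, φ ψ = ψ x := by
  constructor
  · intro hX φ
    obtain ⟨x, rfl⟩ := hX.2 φ
    exact ⟨x, fun _ => rfl⟩
  · intro hX
    refine ⟨fun x y hxy => h.eq_of_apply_eq fun ψ => ?_, fun φ => ?_⟩
    · exact LinearMap.congr_fun hxy ψ
    · obtain ⟨x, hx⟩ := hX φ
      exact ⟨x, LinearMap.ext fun ψ => (hx ψ).symm⟩

theorem IsSimpleHull.refl_of_surjective (h : IsSimpleHull R E e) (g : X →ₗ[R] Y)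
    (hg : Function.Surjective g) (hX : Refl R E X) : Refl R E Y := by
  have := h.inj
  rw [h.refl_iff] at hX ⊢
  intro φ
  obtain ⟨φ', hφ'⟩ := exists_extend (E := E) (LinearMap.lcomp R E g)
    (fun a b hab => LinearMap.ext fun y => by
      obtain ⟨x, rfl⟩ := hg y
      exact LinearMap.congr_fun hab x) φ
  obtain ⟨x, hx⟩ := hX φ'
  exact ⟨g x, fun ψ => by rw [← hφ', hx]; rfl⟩

/-- A functional on `X*`, pulled back to `Y*`, is evaluation at some `y`. Every functional vanishing
on the image of `X` kills `y`, so separation puts `y` in that image. -/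
theorem IsSimpleHull.refl_of_injective (h : IsSimpleHull R E e) (f : X →ₗ[R] Y)
    (hf : Function.Injective f) (hY : Refl R E Y) : Refl R E X := by
  have := h.inj
  rw [h.refl_iff] at hY ⊢
  intro φ
  obtain ⟨y, hy⟩ := hY (φ ∘ₗ LinearMap.lcomp R E f)
  have hmem : y ∈ LinearMap.range f := h.mem_of_apply_eq_zero _ fun ψ hψ => by
    rw [← hy ψ, LinearMap.comp_apply]
    have : LinearMap.lcomp R E f ψ = 0 := LinearMap.ext fun x => hψ _ ⟨x, rfl⟩
    rw [this, map_zero]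
  obtain ⟨x, rfl⟩ := hmem
  refine ⟨x, fun ψ => ?_⟩
  obtain ⟨ψ', hψ'⟩ := exists_extend f hf ψ
  have : LinearMap.lcomp R E f ψ' = ψ := LinearMap.ext hψ'
  rw [← hψ' x, ← hy ψ', LinearMap.comp_apply, this]

theorem IsSimpleHull.refl_equiv (h : IsSimpleHull R E e) (f : X ≃ₗ[R] Y) (hX : Refl R E X) :
    Refl R E Y :=
  h.refl_of_surjective f.toLinearMap f.surjective hX

theorem IsSimpleHull.refl_submodule (h : IsSimpleHull R E e) (N : Submodule R X)
    (hX : Refl R E X) : Refl R E N :=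
  h.refl_of_injective N.subtype N.subtype_injective hX

theorem IsSimpleHull.refl_quotient (h : IsSimpleHull R E e) (N : Submodule R X)
    (hX : Refl R E X) : Refl R E (X ⧸ N) :=
  h.refl_of_surjective N.mkQ N.mkQ_surjective hX

/-- On `(X/N)*` the functional is evaluation at the class of some `y`. After subtracting evaluation
at `y` it factors through the restriction `X* → N*`, where reflexivity of `N` applies. -/
theorem IsSimpleHull.refl_of_submodule_of_quotient (h : IsSimpleHull R E e) (N : Submodule R X)
    (hN : Refl R E N) (hQ : Refl R E (X ⧸ N)) : Refl R E X := by
  have := h.inj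
  have hN' := h.refl_iff.1 hN
  rw [h.refl_iff] at hQ ⊢
  intro φ
  obtain ⟨z, hz⟩ := hQ (φ ∘ₗ LinearMap.lcomp R E N.mkQ)
  obtain ⟨y, rfl⟩ := N.mkQ_surjective z
  set φ₁ : (X →ₗ[R] E) →ₗ[R] E := φ - bidualityMap R X E y with hφ₁
  have hφ₁0 : ∀ ψ : X →ₗ[R] E, (∀ n ∈ N, ψ n = 0) → φ₁ ψ = 0 := by
    intro ψ hψ
    have := hz (N.liftQ ψ fun n hn => hψ n hn)
    have h2 : LinearMap.lcomp R E N.mkQ (N.liftQ ψ fun n hn => hψ n hn) = ψ :=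
      LinearMap.ext fun x => rfl
    rw [LinearMap.comp_apply, h2] at this
    rw [hφ₁, LinearMap.sub_apply, this]
    exact sub_self _
  have hsurj : Function.Surjective (LinearMap.lcomp R E N.subtype) := by
    intro ψ
    obtain ⟨ψ', hψ'⟩ := exists_extend N.subtype N.subtype_injective ψ
    exact ⟨ψ', LinearMap.ext hψ'⟩
  have hker : LinearMap.ker (LinearMap.lcomp R E N.subtype) ≤ LinearMap.ker φ₁ := by
    intro ψ hψ
    exact hφ₁0 ψ fun n hn => LinearMap.congr_fun hψ (⟨n, hn⟩ : N)
  let φ₂ : (N →ₗ[R] E) →ₗ[R] E :=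
    (LinearMap.ker (LinearMap.lcomp R E N.subtype)).liftQ φ₁ hker ∘ₗ
      ((LinearMap.lcomp R E N.subtype).quotKerEquivOfSurjective hsurj).symm.toLinearMap
  have hφ₂ : ∀ ψ : X →ₗ[R] E, φ₂ (LinearMap.lcomp R E N.subtype ψ) = φ₁ ψ := by
    intro ψ
    have : ((LinearMap.lcomp R E N.subtype).quotKerEquivOfSurjective hsurj).symm
        (LinearMap.lcomp R E N.subtype ψ) = Submodule.Quotient.mk ψ := by
      rw [LinearEquiv.symm_apply_eq]
      rfl
    simp only [φ₂, LinearMap.comp_apply, LinearEquiv.coe_coe, this]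
    rfl
  obtain ⟨n, hn⟩ := hN' φ₂
  refine ⟨n + y, fun ψ => ?_⟩
  have h1 := hn (LinearMap.lcomp R E N.subtype ψ)
  rw [hφ₂] at h1
  have h2 : φ ψ = φ₁ ψ + ψ y := by
    rw [hφ₁, LinearMap.sub_apply]
    exact (sub_add_cancel _ _).symm
  rw [h2, h1, map_add]
  rfl

theorem IsSimpleHull.refl_of_exact (h : IsSimpleHull R E e) (f : X →ₗ[R] Y) (g : Y →ₗ[R] Z)
    (hfg : Function.Exact f g) (hX : Refl R E X) (hZ : Refl R E Z) : Refl R E Y := by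
  refine h.refl_of_submodule_of_quotient (LinearMap.ker g) ?_ ?_
  · rw [LinearMap.exact_iff.1 hfg]
    exact h.refl_of_surjective f.rangeRestrict f.surjective_rangeRestrict hX
  · exact h.refl_equiv g.quotKerEquivRange.symm (h.refl_submodule _ hZ)

theorem IsSimpleHull.refl_of_subsingleton (h : IsSimpleHull R E e) [Subsingleton X] :
    Refl R E X := by
  rw [h.refl_iff]
  refine fun φ => ⟨0, fun ψ => ?_⟩
  rw [Subsingleton.elim ψ 0, map_zero]
  rfl

theorem IsSimpleHull.refl_prod (h : IsSimpleHull R E e) (hX : Refl R E X) (hY : Refl R E Y) :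
    Refl R E (X × Y) :=
  h.refl_of_exact (LinearMap.inl R X Y) (LinearMap.snd R X Y) (by
    intro p
    constructor
    · intro hp
      exact ⟨p.1, Prod.ext rfl hp.symm⟩
    · rintro ⟨x, rfl⟩
      rfl) hX hY

theorem IsSimpleHull.refl_pi (h : IsSimpleHull R E e) (hX : Refl R E X) (n : ℕ) :
    Refl R E (Fin n → X) := by
  induction n with
  | zero => exact h.refl_of_subsingleton
  | succ n ih =>
    refine h.refl_equiv (X := X × (Fin n → X)) ?_ (h.refl_prod hX ih)
    exact Fin.consLinearEquiv R (fun _ => X)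

theorem IsSimpleHull.refl_dual (h : IsSimpleHull R E e) (hX : Refl R E X) :
    Refl R E (X →ₗ[R] E) := by
  have hX' := h.refl_iff.1 hX
  rw [h.refl_iff]
  intro Φ
  refine ⟨Φ ∘ₗ bidualityMap R X E, fun χ => ?_⟩
  obtain ⟨x, hx⟩ := hX' χ
  have : χ = bidualityMap R X E x := LinearMap.ext hx
  rw [this]
  rfl

theorem IsSimpleHull.exists_smul_eq (h : IsSimpleHull R E e) {x : E}
    (hx : ∀ r ∈ IsLocalRing.maximalIdeal R, r • x = 0) : ∃ r : R, x = r • e := by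
  by_cases hx0 : x = 0
  · exact ⟨0, by simp [hx0]⟩
  obtain ⟨r, hr⟩ := h.ess x hx0
  have hu : IsUnit r := by
    by_contra hu
    exact h.ne_zero (hr.symm.trans (hx r hu))
  obtain ⟨u, rfl⟩ := hu
  exact ⟨(↑u⁻¹ : R), by rw [← hr, smul_smul, Units.inv_mul, one_smul]⟩

theorem IsSimpleHull.refl_residue (h : IsSimpleHull R E e) :
    Refl R E (R ⧸ IsLocalRing.maximalIdeal R) := by
  rw [h.refl_iff]
  have hmax : ∀ r ∈ IsLocalRing.maximalIdeal R, ∀ y : R ⧸ IsLocalRing.maximalIdeal R,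
      r • y = 0 := by
    intro r hr y
    obtain ⟨s, rfl⟩ := Submodule.Quotient.mk_surjective _ y
    rw [← Submodule.Quotient.mk_smul, Submodule.Quotient.mk_eq_zero]
    exact Ideal.mul_mem_right _ _ hr
  let κ : (R ⧸ IsLocalRing.maximalIdeal R) →ₗ[R] E :=
    Submodule.liftQ (IsLocalRing.maximalIdeal R) (LinearMap.toSpanSingleton R E e)
      (fun r hr => by simpa using h.smul_eq_zero r hr)
  have hκ (r : R) : κ (Submodule.Quotient.mk r) = r • e := rfl
  have hext (ψ : (R ⧸ IsLocalRing.maximalIdeal R) →ₗ[R] E) : ∃ r : R, ψ = r • κ := by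
    obtain ⟨r, hr⟩ := h.exists_smul_eq (x := ψ (Submodule.Quotient.mk 1))
      (fun r hr => by rw [← map_smul, hmax r hr, map_zero])
    refine ⟨r, LinearMap.ext fun y => ?_⟩
    obtain ⟨s, rfl⟩ := Submodule.Quotient.mk_surjective _ y
    have : (Submodule.Quotient.mk s : R ⧸ IsLocalRing.maximalIdeal R) =
      s • Submodule.Quotient.mk 1 := by rw [← Submodule.Quotient.mk_smul, smul_eq_mul, mul_one]
    rw [this, map_smul, hr, map_smul, LinearMap.smul_apply, hκ, one_smul]
  intro φ
  obtain ⟨r, hr⟩ := h.exists_smul_eq (x := φ κ) (fun r hr => by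
    rw [← map_smul]
    have : r • κ = 0 := LinearMap.ext fun y => by
      rw [LinearMap.smul_apply, ← map_smul, hmax r hr, map_zero]; rfl
    rw [this, map_zero])
  refine ⟨Submodule.Quotient.mk r, fun ψ => ?_⟩
  obtain ⟨s, rfl⟩ := hext ψ
  rw [map_smul, hr, LinearMap.smul_apply, hκ]

end Hull

/-! ### Finiteness forced by reflexivity -/

section Finiteness

variable {R : Type u} [CommRing R] [IsLocalRing R] {E : Type u} [AddCommGroup E] [Module R E]
  {e : E}
variable {X : Type u} [AddCommGroup X] [Module R X]

open IsLocalRing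

/-- A functional on the dual taking the same nonzero value at every coordinate map could only be
evaluation at the vector with all coordinates `1`, which must have finite support. -/
theorem IsSimpleHull.finite_of_refl_finsupp (h : IsSimpleHull R E e) (ι : Type u)
    (hX : Refl R E (ι →₀ ResidueField R)) : Finite ι := by
  classical
  have := h.inj
  obtain ⟨κ, hκ, hκ1⟩ := h.exists_isInjectiveHull
  let j : (ι →₀ ResidueField R) →ₗ[R] ((ι →₀ ResidueField R) →ₗ[R] E) :=
    (LinearMap.llcomp R (ι →₀ ResidueField R) (ResidueField R) E κ) ∘ₗ
      (LinearMap.restrictScalarsₗ R (ResidueField R) (ι →₀ ResidueField R) (ResidueField R) R) ∘ₗ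
      ((Finsupp.linearCombination (ResidueField R)
        (fun i : ι => (Finsupp.lapply i : (ι →₀ ResidueField R) →ₗ[ResidueField R] _))).restrictScalars R)
  let σ : (ι →₀ ResidueField R) →ₗ[R] E :=
    κ ∘ₗ ((Finsupp.linearCombination (ResidueField R)
      (fun _ : ι => (1 : ResidueField R))).restrictScalars R)
  have hj (k : ι) (c : ι →₀ ResidueField R) : j c (Finsupp.single k 1) = κ (c k) := by
    simp only [j, LinearMap.comp_apply, LinearMap.llcomp_apply, LinearMap.restrictScalarsₗ_apply,
      LinearMap.restrictScalars_apply]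
    congr 1
    rw [Finsupp.linearCombination_apply, Finsupp.sum, LinearMap.sum_apply]
    simp [Finsupp.single_apply, eq_comm (a := (0 : ResidueField R))]
  have hj1 (i : ι) (x : ι →₀ ResidueField R) : j (Finsupp.single i 1) x = κ (x i) := by
    simp [j]
  have hjinj : Function.Injective j := by
    rw [injective_iff_map_eq_zero]
    intro c hc
    ext k
    have := hj k c
    rw [hc] at this
    exact hκ.injective_map (this.symm.trans (by simp))
  obtain ⟨φ, hφ⟩ := exists_extend j hjinj σ
  obtain ⟨x, hx⟩ := h.refl_iff.1 hX φ
  have hx1 (i : ι) : x i = 1 := by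
    have h1 := hφ (Finsupp.single i 1)
    rw [hx, hj1] at h1
    refine hκ.injective_map (h1.trans ?_)
    simp [σ]
  have : Set.Finite (Set.univ : Set ι) := by
    refine x.support.finite_toSet.subset fun i _ => ?_
    simp [hx1 i]
  exact Set.finite_univ_iff.1 this

theorem IsSimpleHull.finite_of_refl_of_smul_eq_zero (h : IsSimpleHull R E e) (hX : Refl R E X)
    (hm : ∀ r ∈ maximalIdeal R, ∀ x : X, r • x = 0) : Module.Finite R X := by
  have ht : Module.IsTorsionBySet R X (maximalIdeal R : Set R) := fun x r => hm r r.2 x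
  let _ : Module (ResidueField R) X := ht.module
  have : IsScalarTower R (ResidueField R) X := ht.isScalarTower
  let b := Module.Basis.ofVectorSpace (ResidueField R) X
  have := h.finite_of_refl_finsupp _ (h.refl_equiv (b.repr.restrictScalars R) hX)
  have : Module.Finite (ResidueField R) X := Module.Finite.of_basis b
  exact Module.Finite.trans (ResidueField R) X

/-- Every element is killed by a power of the maximal ideal. -/
def IsMaxTorsion (R : Type u) [CommRing R] [IsLocalRing R] (X : Type u) [AddCommGroup X]
    [Module R X] : Prop :=
  ∀ x : X, ∃ n : ℕ, ∀ r ∈ maximalIdeal R ^ n, r • x = 0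

theorem exists_smul_mem_socle (n : ℕ) (x : X) (hx : x ≠ 0)
    (hn : ∀ r ∈ maximalIdeal R ^ n, r • x = 0) :
    ∃ r : R, r • x ≠ 0 ∧ ∀ s ∈ maximalIdeal R, s • r • x = 0 := by
  induction n generalizing x with
  | zero => exact absurd (by simpa using hn 1 (by simp)) hx
  | succ n ih =>
    by_cases hs : ∀ s ∈ maximalIdeal R, s • x = 0
    · exact ⟨1, by simpa using hx, by simpa using hs⟩
    · push Not at hs
      obtain ⟨s, hs, hsx⟩ := hs
      obtain ⟨r, hr, hr'⟩ := ih (s • x) hsx fun t ht => by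
        rw [smul_smul]
        exact hn _ (pow_succ (maximalIdeal R) n ▸ Ideal.mul_mem_mul ht hs)
      exact ⟨r * s, by rwa [mul_smul], by simpa only [mul_smul] using hr'⟩

theorem exists_pow_smul_inf_le {R : Type u} [CommRing R] {X : Type u} [AddCommGroup X]
    [Module R X] [IsNoetherianRing R] (I : Ideal R) (N N' : Submodule R X)
    (hN' : N'.FG) (hle : N ≤ N') :
    ∃ k : ℕ, ∀ n, I ^ (k + n) • N' ⊓ N ≤ I ^ n • N := by
  have : Module.Finite R N' := Module.Finite.iff_fg.2 hN'
  obtain ⟨k, hk⟩ := I.exists_pow_inf_eq_pow_smul (N.comap N'.subtype)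
  refine ⟨k, fun n => ?_⟩
  have h1 := hk (k + n) (Nat.le_add_right _ _)
  have h2 := congrArg (Submodule.map N'.subtype) h1
  rw [Submodule.map_inf _ N'.subtype_injective, Submodule.map_smul'', Submodule.map_top,
    Submodule.range_subtype, Submodule.map_smul'', Submodule.map_inf _ N'.subtype_injective,
    Submodule.map_comap_subtype, inf_eq_right.2 hle, Nat.add_sub_cancel_left] at h2
  rw [h2]
  exact Submodule.smul_mono le_rfl inf_le_right

/-- Inductive step for a quotient with large socle: `s` becomes a socle element modulo `L'` not
coming from `N`, while `L'` meets `N` in nothing beyond `L`. -/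
theorem exists_enlarge [IsNoetherianRing R] (N L : Submodule R X) (hLN : L ≤ N) (hN : N.FG)
    (hL : ∃ n, maximalIdeal R ^ n • N ≤ L) (x : X)
    (hx : ∀ n, ∃ r ∈ maximalIdeal R ^ n, r • x ∉ N) :
    ∃ (N' L' : Submodule R X) (s : X), N ≤ N' ∧ L ≤ L' ∧ L' ≤ N' ∧ N'.FG ∧
      (∃ n, maximalIdeal R ^ n • N' ≤ L') ∧ L' ⊓ N ≤ L ∧ s ∈ N' ∧
      (∀ r ∈ maximalIdeal R, r • s ∈ L') ∧ s ∉ N ⊔ L' := by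
  obtain ⟨n, hn⟩ := hL
  have hN' : (N ⊔ R ∙ x).FG := hN.sup (Submodule.fg_span_singleton x)
  -- The Artin–Rees shift `k` ensures that what is added to `L` meets `N` inside `m ^ n • N`, hence
  -- inside `L`.
  obtain ⟨k, hk⟩ := exists_pow_smul_inf_le (maximalIdeal R) N (N ⊔ R ∙ x) hN' le_sup_left
  set N' := N ⊔ R ∙ x with hN'def
  set m := maximalIdeal R
  have hmono : m ^ (k + n + 1) • N' ≤ m ^ (k + n) • N' :=
    Submodule.smul_mono_left (Ideal.pow_le_pow_right (Nat.le_succ _))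
  have hs : ∃ s ∈ m ^ (k + n) • N', s ∉ N ⊔ m ^ (k + n + 1) • N' := by
    by_contra! hcon
    -- Nakayama: without such an `s`, a power of the maximal ideal would carry `x` into `N`.
    have hle : m ^ (k + n) • N' ≤ N := by
      refine Submodule.le_of_le_smul_of_le_jacobson_bot (I := m) ?_ ?_ ?_
      · exact Submodule.FG.smul (IsNoetherian.noetherian _) hN'
      · exact (IsLocalRing.jacobson_eq_maximalIdeal ⊥ bot_ne_top).ge
      · intro y hy
        have := hcon y hy
        rwa [pow_succ', mul_smul] at this
    obtain ⟨r, hr, hrx⟩ := hx (k + n)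
    exact hrx (hle (Submodule.smul_mem_smul hr
      (Submodule.mem_sup_right (Submodule.mem_span_singleton_self x))))
  obtain ⟨s, hs, hs'⟩ := hs
  refine ⟨N', L ⊔ m ^ (k + n + 1) • N', s, le_sup_left, le_sup_left,
    sup_le (hLN.trans le_sup_left) Submodule.smul_le_right, hN', ⟨k + n + 1, le_sup_right⟩, ?_,
    Submodule.smul_le_right hs, ?_, ?_⟩
  · rw [sup_inf_assoc_of_le _ hLN]
    refine sup_le le_rfl ?_
    exact (inf_le_inf_right _ hmono).trans ((hk n).trans hn)
  · intro r hr
    refine Submodule.mem_sup_right ?_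
    rw [pow_succ', mul_smul]
    exact Submodule.smul_mem_smul hr hs
  · rwa [← sup_assoc, sup_eq_left.2 hLN]

/-- If no such `N` existed, iterating `exists_enlarge` would give chains `N n`, `L n`. Modulo the
union of the `L n`, the images of the `N n` would cut out a strictly increasing chain in the socle,
although the socle of a reflexive module is finite. -/
theorem IsSimpleHull.exists_fg_isMaxTorsion_quotient [IsNoetherianRing R]
    (h : IsSimpleHull R E e) (hX : Refl R E X) :
    ∃ N : Submodule R X, N.FG ∧ IsMaxTorsion R (X ⧸ N) := by
  by_contra! hcon
  have hstep : ∀ N : Submodule R X, N.FG →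
      ∃ x, ∀ n, ∃ r ∈ maximalIdeal R ^ n, r • x ∉ N := by
    intro N hN
    have := hcon N hN
    simp only [IsMaxTorsion, not_forall, not_exists] at this
    obtain ⟨x, hx⟩ := this
    obtain ⟨x, rfl⟩ := N.mkQ_surjective x
    refine ⟨x, fun n => ?_⟩
    obtain ⟨r, hr, hrx⟩ := hx n
    refine ⟨r, hr, fun hmem => hrx ?_⟩
    rw [← map_smul]
    exact (Submodule.Quotient.mk_eq_zero N).2 hmem
  let S := {p : Submodule R X × Submodule R X //
    p.2 ≤ p.1 ∧ p.1.FG ∧ ∃ n, maximalIdeal R ^ n • p.1 ≤ p.2}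
  have hnext : ∀ p : S, ∃ (q : S) (s : X), p.1.1 ≤ q.1.1 ∧ p.1.2 ≤ q.1.2 ∧
      q.1.2 ⊓ p.1.1 ≤ p.1.2 ∧ s ∈ q.1.1 ∧ (∀ r ∈ maximalIdeal R, r • s ∈ q.1.2) ∧
      s ∉ p.1.1 ⊔ q.1.2 := by
    rintro ⟨⟨N, L⟩, h1, h2, h3⟩
    obtain ⟨x, hx⟩ := hstep N h2
    obtain ⟨N', L', s, a1, a2, a3, a4, a5, a6, a7, a8, a9⟩ := exists_enlarge N L h1 h2 h3 x hx
    exact ⟨⟨⟨N', L'⟩, a3, a4, a5⟩, s, a1, a2, a6, a7, a8, a9⟩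
  choose nx sx h1 h2 h3 h4 h5 h6 using hnext
  let p0 : S := ⟨(⊥, ⊥), le_rfl, Submodule.fg_bot, 0, Submodule.smul_le_right⟩
  let p : ℕ → S := fun n => Nat.rec p0 (fun _ q => nx q) n
  have hp (n : ℕ) : p (n + 1) = nx (p n) := rfl
  let N : ℕ → Submodule R X := fun n => (p n).1.1
  let L : ℕ → Submodule R X := fun n => (p n).1.2
  let s : ℕ → X := fun n => sx (p n)
  have hN : Monotone N := monotone_nat_of_le_succ fun n => h1 (p n)
  have hL : Monotone L := monotone_nat_of_le_succ fun n => h2 (p n)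
  have hinf (n j : ℕ) : L (n + j) ⊓ N n ≤ L n := by
    induction j with
    | zero => exact inf_le_left
    | succ j ih =>
      refine le_trans ?_ ih
      refine le_inf ?_ inf_le_right
      exact le_trans (inf_le_inf_left _ (hN (Nat.le_add_right n j))) (h3 (p (n + j)))
  let Lω : Submodule R X := ⨆ n, L n
  have hmemω (x : X) : x ∈ Lω ↔ ∃ n, x ∈ L n := Submodule.mem_iSup_of_directed _ hL.directed_le
  have hinfω (n : ℕ) (x : X) (hx : x ∈ Lω) (hxN : x ∈ N n) : x ∈ L n := by
    obtain ⟨j, hj⟩ := (hmemω x).1 hx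
    exact hinf n j ⟨hL (Nat.le_add_left j n) hj, hxN⟩
  have hs (n : ℕ) : s n ∉ N n ⊔ Lω := by
    intro hmem
    obtain ⟨y, hy, l, hl, hyl⟩ := Submodule.mem_sup.1 hmem
    refine h6 (p n) (Submodule.mem_sup.2 ⟨y, hy, l, hinfω (n + 1) l hl ?_, hyl⟩)
    have : l = s n - y := by rw [← hyl]; abel
    rw [this]
    exact sub_mem (h4 (p n)) (hN (Nat.le_succ n) hy)
  let W : Submodule R (X ⧸ Lω) := Submodule.torsionBySet R (X ⧸ Lω) (maximalIdeal R)
  have hWfin : Module.Finite R W := by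
    refine h.finite_of_refl_of_smul_eq_zero (h.refl_submodule W (h.refl_quotient Lω hX)) ?_
    intro r hr w
    exact Subtype.ext ((Submodule.mem_torsionBySet_iff _ _).1 w.2 ⟨r, hr⟩)
  let A : ℕ →o Submodule R W :=
    ⟨fun n => ((N n).map Lω.mkQ).comap W.subtype, fun a b hab =>
      Submodule.comap_mono (Submodule.map_mono (hN hab))⟩
  obtain ⟨n, hn⟩ := monotone_stabilizes_iff_noetherian.2 (isNoetherian_of_isNoetherianRing_of_finite R W) A
  have hsW : Lω.mkQ (s n) ∈ W := by
    rw [Submodule.mem_torsionBySet_iff]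
    rintro ⟨r, hr⟩
    change r • Lω.mkQ (s n) = 0
    rw [← map_smul]
    exact (Submodule.Quotient.mk_eq_zero _).2 ((hmemω _).2 ⟨n + 1, h5 (p n) r hr⟩)
  have hA1 : (⟨_, hsW⟩ : W) ∈ A (n + 1) := ⟨s n, h4 (p n), rfl⟩
  rw [← hn (n + 1) (Nat.le_succ n)] at hA1
  obtain ⟨y, hy, hys⟩ := hA1
  refine hs n (Submodule.mem_sup.2 ⟨y, hy, s n - y, ?_, by abel⟩)
  rw [← Submodule.Quotient.mk_eq_zero]
  have : Lω.mkQ y = Lω.mkQ (s n) := hys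
  change Lω.mkQ (s n - y) = 0
  rw [map_sub, this, sub_self]

theorem IsSimpleHull.exists_fg_sup_smul_top (h : IsSimpleHull R E e) (hX : Refl R E X) :
    ∃ N : Submodule R X, N.FG ∧ N ⊔ maximalIdeal R • ⊤ = ⊤ := by
  have hfin : Module.Finite R (X ⧸ (maximalIdeal R • ⊤ : Submodule R X)) := by
    refine h.finite_of_refl_of_smul_eq_zero (h.refl_quotient _ hX) fun r hr x => ?_
    obtain ⟨x, rfl⟩ := Submodule.mkQ_surjective _ x
    rw [← map_smul]
    exact (Submodule.Quotient.mk_eq_zero _).2 (Submodule.smul_mem_smul hr trivial)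
  obtain ⟨n, t, ht⟩ := Module.Finite.exists_fin (R := R)
    (M := X ⧸ (maximalIdeal R • ⊤ : Submodule R X))
  choose y hy using fun i => Submodule.mkQ_surjective _ (t i)
  refine ⟨Submodule.span R (Set.range y), Submodule.fg_span (Set.finite_range y), ?_⟩
  rw [sup_comm, ← Submodule.map_mkQ_eq_top, Submodule.map_span, ← Set.range_comp, ← ht]
  congr 2
  exact funext hy

/-- A Nakayama argument without prior finiteness: a functional on `X*` vanishing on `N` is
evaluation at some `x`. If `x ≠ 0`, a nonzero socle multiple of `x` is killed by `N` and by `m X*`,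
hence by all of `X*`, contradicting separation. -/
theorem IsSimpleHull.finite_dual (h : IsSimpleHull R E e) (hX : Refl R E X)
    (ht : IsMaxTorsion R X) : Module.Finite R (X →ₗ[R] E) := by
  obtain ⟨N, hN, hN'⟩ := h.exists_fg_sup_smul_top (h.refl_dual hX)
  suffices N = ⊤ from ⟨this ▸ hN⟩
  rw [eq_top_iff]
  intro ψ _
  refine h.mem_of_apply_eq_zero N fun χ hχ => ?_
  obtain ⟨x, hx⟩ := h.refl_iff.1 hX χ
  suffices x = 0 by rw [hx, this, map_zero]
  by_contra hx0
  obtain ⟨n, hn⟩ := ht x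
  obtain ⟨r, hr, hr'⟩ := exists_smul_mem_socle n x hx0 hn
  refine hr (h.eq_of_apply_eq fun ψ => ?_)
  rw [map_zero]
  have hψ : ψ ∈ N ⊔ maximalIdeal R • ⊤ := hN'.symm ▸ Submodule.mem_top
  obtain ⟨y, hy, z, hz, rfl⟩ := Submodule.mem_sup.1 hψ
  have h1 : y (r • x) = 0 := by rw [map_smul, ← hx, hχ y hy, smul_zero]
  have h2 : z (r • x) = 0 := by
    refine Submodule.smul_induction_on hz ?_ ?_
    · intro s hs w _
      rw [LinearMap.smul_apply, ← map_smul, hr' s hs, map_zero]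
    · intro a b ha hb
      rw [LinearMap.add_apply, ha, hb, add_zero]
  rw [LinearMap.add_apply, h1, h2, add_zero]

end Finiteness

/-! ### Annihilating ideals with reflexive quotient ring -/

section Cyclic

variable {R : Type u} [CommRing R] [IsLocalRing R] {E : Type u} [AddCommGroup E] [Module R E]
  {e : E}
variable {X : Type u} [AddCommGroup X] [Module R X]

open IsLocalRing

theorem IsSimpleHull.refl_quotient_ker (h : IsSimpleHull R E e) (hX : Refl R E X)
    (f : R →ₗ[R] X) {I : Ideal R} (hI : LinearMap.ker f = I) : Refl R E (R ⧸ I) := by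
  subst hI
  exact h.refl_equiv f.quotKerEquivRange.symm (h.refl_submodule _ hX)

theorem IsSimpleHull.refl_quotient_annihilator (h : IsSimpleHull R E e) (hX : Refl R E X)
    [Module.Finite R X] : Refl R E (R ⧸ Module.annihilator R X) := by
  obtain ⟨n, t, ht⟩ := Module.Finite.exists_fin (R := R) (M := X)
  refine h.refl_quotient_ker (h.refl_pi hX n)
    (LinearMap.pi fun i => LinearMap.toSpanSingleton R X (t i)) ?_
  ext r
  rw [← Submodule.annihilator_top, ← ht, Submodule.mem_annihilator_span]
  simp [funext_iff]

theorem IsSimpleHull.refl_quotient_inf (h : IsSimpleHull R E e) {I J : Ideal R}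
    (hI : Refl R E (R ⧸ I)) (hJ : Refl R E (R ⧸ J)) : Refl R E (R ⧸ I ⊓ J) :=
  h.refl_quotient_ker (h.refl_prod hI hJ) (LinearMap.prod I.mkQ J.mkQ) (by simp)

/-- `R/J²` is an extension of `R/J` by `J/J²`, and the latter is a quotient of a finite power of
`R/J`. -/
theorem IsSimpleHull.refl_quotient_mul_self [IsNoetherianRing R] (h : IsSimpleHull R E e)
    {J : Ideal R} (hJ : Refl R E (R ⧸ J)) : Refl R E (R ⧸ J * J) := by
  obtain ⟨n, a, ha⟩ := Submodule.fg_iff_exists_fin_generating_family.1 (IsNoetherian.noetherian J)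
  have haJ (i : Fin n) : a i ∈ J := ha ▸ Submodule.subset_span ⟨i, rfl⟩
  let f : (Fin n → R ⧸ J) →ₗ[R] R ⧸ J * J := LinearMap.lsum R (fun _ => R ⧸ J) R fun i =>
    J.liftQ ((J * J).mkQ ∘ₗ LinearMap.toSpanSingleton R R (a i)) fun r hr => by
      simpa using (Submodule.Quotient.mk_eq_zero (J * J)).2 (Ideal.mul_mem_mul hr (haJ i))
  have hf (c : Fin n → R) : f (fun i => J.mkQ (c i)) = (J * J).mkQ (∑ i, c i • a i) := by
    rw [map_sum]
    simp only [f, LinearMap.lsum_apply, LinearMap.sum_apply, LinearMap.comp_apply,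
      LinearMap.proj_apply]
    rfl
  refine h.refl_of_exact f (Submodule.factor Ideal.mul_le_left : R ⧸ J * J →ₗ[R] R ⧸ J) ?_
    (h.refl_pi hJ n) hJ
  intro y
  obtain ⟨r, rfl⟩ := Submodule.mkQ_surjective _ y
  have h1 : (Submodule.factor Ideal.mul_le_left : R ⧸ J * J →ₗ[R] R ⧸ J) ((J * J).mkQ r) = 0 ↔
      r ∈ J := Submodule.Quotient.mk_eq_zero J
  rw [h1]
  constructor
  · intro hr
    rw [← ha] at hr
    obtain ⟨c, rfl⟩ := (Submodule.mem_span_range_iff_exists_fun R).1 hr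
    exact ⟨fun i => J.mkQ (c i), hf c⟩
  · rintro ⟨c, hc⟩
    choose d hd using fun i => Submodule.mkQ_surjective J (c i)
    have hcd : c = fun i => J.mkQ (d i) := funext fun i => (hd i).symm
    rw [hcd, hf] at hc
    have hmem : (∑ i, d i • a i) - r ∈ J * J := by
      rw [← Submodule.Quotient.mk_eq_zero]
      exact (map_sub (J * J).mkQ _ _).trans (by rw [hc, sub_self])
    have hsum : ∑ i, d i • a i ∈ J := sum_mem fun i _ => J.smul_mem _ (haJ i)
    simpa using sub_mem hsum (Ideal.mul_le_left hmem)

theorem IsSimpleHull.annihilator_dual_le (h : IsSimpleHull R E e) :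
    Module.annihilator R (X →ₗ[R] E) ≤ Module.annihilator R X := by
  intro r hr
  rw [Module.mem_annihilator] at hr ⊢
  intro x
  refine h.eq_of_apply_eq fun ψ => ?_
  rw [map_zero, map_smul, ← LinearMap.smul_apply, hr, LinearMap.zero_apply]

theorem IsSimpleHull.exists_refl_quotient_ideal [IsNoetherianRing R] (h : IsSimpleHull R E e)
    (hX : Refl R E X) : ∃ I : Ideal R, I ≤ maximalIdeal R ∧ (∀ r ∈ I, ∀ x : X, r • x = 0) ∧
      Refl R E (R ⧸ I) := by
  obtain ⟨N, hN, hQ⟩ := h.exists_fg_isMaxTorsion_quotient hX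
  have hQr := h.refl_quotient N hX
  have := h.finite_dual hQr hQ
  have : Module.Finite R N := Module.Finite.iff_fg.2 hN
  set J₁ := Module.annihilator R N with hJ₁
  set J₂ := Module.annihilator R ((X ⧸ N) →ₗ[R] E) with hJ₂
  have h1 : Refl R E (R ⧸ J₁) := h.refl_quotient_annihilator (h.refl_submodule N hX)
  have h2 : Refl R E (R ⧸ J₂) := h.refl_quotient_annihilator (h.refl_dual hQr)
  have h3 := h.refl_quotient_inf (h.refl_quotient_inf h1 h2) h.refl_residue
  -- The ideal is the square of `J₁ ⊓ J₂ ⊓ m`: one factor moves `X` into `N`, the other kills `N`.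
  refine ⟨_, Ideal.mul_le_left.trans inf_le_right, ?_, h.refl_quotient_mul_self h3⟩
  intro r hr x
  refine Submodule.smul_induction_on (p := fun r => r • x = 0) hr ?_ ?_
  · rintro a ⟨⟨ha, -⟩, -⟩ b ⟨⟨-, hb⟩, -⟩
    have hb' : b • x ∈ N := by
      rw [← Submodule.Quotient.mk_eq_zero]
      exact Module.mem_annihilator.1 (h.annihilator_dual_le hb) (Submodule.Quotient.mk x)
    rw [smul_assoc]
    exact congrArg Subtype.val (Module.mem_annihilator.1 ha ⟨_, hb'⟩)
  · intro a b ha hb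
    rw [add_smul, ha, hb, add_zero]

/-- Generators of the finite dual of the socle extend to `X` and define a map to a power of
`(R/I)*`. It is injective, since every nonzero element of a torsion module has a nonzero multiple in
the socle. -/
theorem IsSimpleHull.refl_of_isMaxTorsion [IsNoetherianRing R] (h : IsSimpleHull R E e)
    (ht : IsMaxTorsion R X) (hs : Refl R E (Submodule.torsionBySet R X (maximalIdeal R)))
    {I : Ideal R} (hI : ∀ r ∈ I, ∀ x : X, r • x = 0) (hIr : Refl R E (R ⧸ I)) :
    Refl R E X := by
  have := h.inj
  set W := Submodule.torsionBySet R X (maximalIdeal R) with hW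
  have hWz : ∀ r ∈ maximalIdeal R, ∀ w : W, r • w = 0 := fun r hr w =>
    Subtype.ext ((Submodule.mem_torsionBySet_iff _ _).1 w.2 ⟨r, hr⟩)
  have hfin : Module.Finite R (W →ₗ[R] E) :=
    h.finite_of_refl_of_smul_eq_zero (h.refl_dual hs) fun r hr ψ => LinearMap.ext fun w => by
      rw [LinearMap.smul_apply, ← map_smul, hWz r hr, map_zero, LinearMap.zero_apply]
  obtain ⟨n, ψ, hψ⟩ := Module.Finite.exists_fin (R := R) (M := W →ₗ[R] E)
  choose χ hχ using fun i => exists_extend W.subtype W.subtype_injective (ψ i)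
  let act : X →ₗ[R] (R ⧸ I) →ₗ[R] X :=
    (I.liftQ (LinearMap.lsmul R X) fun r hr => LinearMap.ext (hI r hr)).flip
  have hact (x : X) : act x (Submodule.Quotient.mk 1) = x := by
    change (1 : R) • x = x
    exact one_smul _ _
  let F : X →ₗ[R] (Fin n → (R ⧸ I) →ₗ[R] E) :=
    LinearMap.pi fun i => (LinearMap.llcomp R (R ⧸ I) X E (χ i)) ∘ₗ act
  have hF (x : X) (hx : F x = 0) (i : Fin n) : χ i x = 0 := by
    have := LinearMap.congr_fun (congrFun hx i) (Submodule.Quotient.mk 1)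
    have h2 : χ i (act x (Submodule.Quotient.mk 1)) = 0 := this
    rwa [hact] at h2
  refine h.refl_of_injective F ?_ (h.refl_pi (h.refl_dual hIr) n)
  rw [injective_iff_map_eq_zero]
  intro x hx
  by_contra hx0
  obtain ⟨k, hk⟩ := ht x
  obtain ⟨r, hr, hr'⟩ := exists_smul_mem_socle k x hx0 hk
  have hrW : r • x ∈ W := (Submodule.mem_torsionBySet_iff _ _).2 fun s => hr' s s.2
  have : (⟨r • x, hrW⟩ : W) = 0 := by
    refine h.eq_of_apply_eq fun φ => ?_
    rw [map_zero]
    have hφ : φ ∈ Submodule.span R (Set.range ψ) := hψ ▸ trivial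
    refine Submodule.span_induction (p := fun φ _ => φ (⟨r • x, hrW⟩ : W) = 0) ?_ rfl ?_ ?_ hφ
    · rintro _ ⟨i, rfl⟩
      rw [← hχ i]
      change χ i (r • x) = 0
      rw [map_smul, hF x hx, smul_zero]
    · intro a b _ _ ha hb
      rw [LinearMap.add_apply, ha, hb, add_zero]
    · intro c a _ ha
      rw [LinearMap.smul_apply, ha, smul_zero]
  exact hr (congrArg Subtype.val this)

end Cyclic

open IsLocalRing

/-! ### Reflexive modules are precomplete -/

section Precomplete

variable {R : Type u} [CommRing R] [IsLocalRing R] {E : Type u} [AddCommGroup E] [Module R E]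
  {e : E} {X : Type u} [AddCommGroup X] [Module R X]

/-- On functionals killing some `I ^ n X`, the values along a Cauchy sequence stabilize. The stable
value extends to a functional on `X*`, and the element representing it is the limit. -/
theorem IsSimpleHull.isPrecomplete_of_refl (h : IsSimpleHull R E e) (hX : Refl R E X)
    (I : Ideal R) : IsPrecomplete I X := by
  have := h.inj
  refine ⟨fun f hf => ?_⟩
  let D : ℕ → Submodule R (X →ₗ[R] E) := fun n =>
    { carrier := {ψ | ∀ y ∈ (I ^ n • ⊤ : Submodule R X), ψ y = 0}
      add_mem' := fun {a b} ha hb y hy => by rw [LinearMap.add_apply, ha y hy, hb y hy, add_zero]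
      zero_mem' := fun _ _ => rfl
      smul_mem' := fun c a ha y hy => by rw [LinearMap.smul_apply, ha y hy, smul_zero] }
  have hD : Monotone D := fun a b hab ψ hψ y hy =>
    hψ y (Submodule.smul_mono_left (Ideal.pow_le_pow_right hab) hy)
  have key : ∀ {a b : ℕ}, a ≤ b → ∀ ψ ∈ D a, ψ (f a) = ψ (f b) := by
    intro a b hab ψ hψ
    rw [← sub_eq_zero, ← map_sub]
    exact hψ _ (SModEq.sub_mem.1 (hf hab))
  have key' : ∀ {a b : ℕ} (ψ), ψ ∈ D a → ψ ∈ D b → ψ (f a) = ψ (f b) := by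
    intro a b ψ ha hb
    rcases le_total a b with hab | hab
    · exact key hab ψ ha
    · exact (key hab ψ hb).symm
  have hU (ψ : ↥(⨆ n, D n)) : ∃ n, ψ.1 ∈ D n :=
    (Submodule.mem_iSup_of_directed D hD.directed_le).1 ψ.2
  choose N hN using hU
  let φ : ↥(⨆ n, D n) →ₗ[R] E :=
    { toFun := fun ψ => ψ.1 (f (N ψ))
      map_add' := fun a b => by
        have h1 := hD (le_max_left (N a) (N b)) (hN a)
        have h2 := hD (le_max_right (N a) (N b)) (hN b)
        rw [key' _ (hN (a + b)) ((D (max (N a) (N b))).add_mem h1 h2), key' _ (hN a) h1,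
          key' _ (hN b) h2]
        rfl
      map_smul' := fun c a => by
        rw [key' _ (hN (c • a)) ((D (N a)).smul_mem c (hN a))]
        rfl }
  obtain ⟨φ', hφ'⟩ := exists_extend (⨆ n, D n).subtype (Submodule.subtype_injective _) φ
  obtain ⟨x, hx⟩ := h.refl_iff.1 hX φ'
  refine ⟨x, fun n => SModEq.sub_mem.2 (h.mem_of_apply_eq_zero _ fun ψ hψ => ?_)⟩
  have hmem : ψ ∈ ⨆ n, D n := Submodule.mem_iSup_of_mem n hψ
  rw [map_sub, sub_eq_zero, ← hx ψ]
  exact (key' ψ hψ (hN ⟨ψ, hmem⟩)).trans (hφ' ⟨ψ, hmem⟩).symm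

end Precomplete

/-! ### `R/I` as a quotient of the completion -/

section Completion

variable {R : Type u} [CommRing R] [IsNoetherianRing R]

/-- `J` is the kernel of the completed projection to the completion of `R/I`, which is `R/I` itself.
By exactness of completion `J` is the image of the completion of `I`, so generators of `I` generate
it. -/
theorem exists_ideal_adicCompletion [IsLocalRing R] (I : Ideal R)
    (hI : IsPrecomplete (maximalIdeal R) (R ⧸ I)) :
    ∃ J : Ideal (LocalCompletion R), J.comap (algebraMap R (LocalCompletion R)) = I ∧
      J ≤ I.map (algebraMap R (LocalCompletion R)) ∧
      ∀ s : LocalCompletion R, ∃ r : R, s - algebraMap R (LocalCompletion R) r ∈ J := by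
  set m := maximalIdeal R
  have halg (r : R) : algebraMap R (LocalCompletion R) r = AdicCompletion.of m R r := rfl
  let J : Ideal (LocalCompletion R) :=
    { carrier := {s | AdicCompletion.map m I.mkQ s = 0}
      add_mem' := fun {a b} ha hb => (map_add _ a b).trans (by rw [ha, hb, add_zero])
      zero_mem' := map_zero _
      smul_mem' := fun c a ha => (map_smul (AdicCompletion.map m I.mkQ) c a).trans
        (by rw [ha, smul_zero]) }
  have hmem (s : LocalCompletion R) : s ∈ J ↔ AdicCompletion.map m I.mkQ s = 0 := Iff.rfl
  refine ⟨J, ?_, ?_, ?_⟩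
  · ext r
    rw [Ideal.mem_comap, hmem, halg, AdicCompletion.map_of, ← map_zero (AdicCompletion.of m (R ⧸ I)),
      AdicCompletion.of_inj]
    exact Submodule.Quotient.mk_eq_zero I
  · intro s hs
    obtain ⟨n, a, ha⟩ :=
      Submodule.fg_iff_exists_fin_generating_family.1 (IsNoetherian.noetherian I)
    have haI (i : Fin n) : a i ∈ I := ha ▸ Submodule.subset_span ⟨i, rfl⟩
    let f : (Fin n → R) →ₗ[R] I := Fintype.linearCombination R fun i => ⟨a i, haI i⟩
    have hfv (c : Fin n → R) : (f c : R) = ∑ i, c i * a i := by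
      simp [f, Fintype.linearCombination_apply]
    have hf : Function.Surjective f := by
      rintro ⟨x, hx⟩
      rw [← ha] at hx
      obtain ⟨c, rfl⟩ := (Submodule.mem_span_range_iff_exists_fun R).1 hx
      exact ⟨c, Subtype.ext (hfv c)⟩
    obtain ⟨d, rfl⟩ := (AdicCompletion.map_exact (I := m) I.subtype_injective
      (LinearMap.exact_subtype_mkQ I) I.mkQ_surjective s).1 ((hmem s).1 hs)
    obtain ⟨c, rfl⟩ := AdicCompletion.map_surjective m hf d
    have hc : AdicCompletion.map m I.subtype (AdicCompletion.map m f c) =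
        ∑ i, AdicCompletion.map m (LinearMap.proj i) c *
          algebraMap R (LocalCompletion R) (a i) := by
      obtain ⟨b, rfl⟩ := AdicCompletion.mk_surjective m _ c
      ext k
      simp [hfv, halg, AdicCompletion.val_sum_apply]
    rw [hc]
    refine sum_mem fun i _ => Ideal.mul_mem_left _ _ (Ideal.mem_map_of_mem _ (haI i))
  · intro s
    obtain ⟨y, hy⟩ := AdicCompletion.of_surjective m (R ⧸ I) (AdicCompletion.map m I.mkQ s)
    obtain ⟨r, rfl⟩ := I.mkQ_surjective y
    refine ⟨r, ?_⟩
    rw [hmem, map_sub, halg, AdicCompletion.map_of, hy, sub_self]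

end Completion

/-! ### Change of rings through a common quotient -/

section Transfer

variable {R S : Type u} [CommRing R] [CommRing S] [Algebra R S]

theorem exists_module_of_surjective (I : Ideal R) (J : Ideal S)
    (hI : J.comap (algebraMap R S) = I) (hJ : ∀ s : S, ∃ r : R, s - algebraMap R S r ∈ J)
    (L : Type u) [AddCommGroup L] [Module R L] (hL : ∀ r ∈ I, ∀ x : L, r • x = 0) :
    ∃ _ : Module S L, IsScalarTower R S L ∧ ∀ j ∈ J, ∀ x : L, j • x = 0 := by
  have hbij : Function.Bijective (Ideal.quotientMap J (algebraMap R S) hI.ge) := by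
    refine ⟨Ideal.quotientMap_injective' hI.le, fun y => ?_⟩
    obtain ⟨s, rfl⟩ := Ideal.Quotient.mk_surjective y
    obtain ⟨r, hr⟩ := hJ s
    refine ⟨Ideal.Quotient.mk I r, ?_⟩
    rw [Ideal.quotientMap_mk]
    exact ((Ideal.Quotient.mk_eq_mk_iff_sub_mem _ _).2 hr).symm
  let ε := RingEquiv.ofBijective _ hbij
  have ht : Module.IsTorsionBySet R L (I : Set R) := fun x r => hL r r.2 x
  let _ : Module (R ⧸ I) L := ht.module
  have : IsScalarTower R (R ⧸ I) L := ht.isScalarTower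
  let π : S →+* R ⧸ I := (ε.symm : (S ⧸ J) →+* R ⧸ I).comp (Ideal.Quotient.mk J)
  have hπ (r : R) : π (algebraMap R S r) = Ideal.Quotient.mk I r := by
    change ε.symm (Ideal.Quotient.mk J (algebraMap R S r)) = _
    rw [RingEquiv.symm_apply_eq]
    rfl
  let inst : Module S L := Module.compHom L π
  have hs (s : S) (x : L) : s • x = π s • x := rfl
  refine ⟨inst, ⟨fun r s x => ?_⟩, fun j hj x => ?_⟩
  · rw [hs, hs, Algebra.smul_def, map_mul, hπ, mul_smul]
    exact algebraMap_smul (R ⧸ I) r (π s • x)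
  · rw [hs]
    have : π j = 0 := by
      change ε.symm (Ideal.Quotient.mk J j) = 0
      rw [Ideal.Quotient.eq_zero_iff_mem.2 hj, map_zero]
    rw [this, zero_smul]

theorem smul_eq_of_sub_mem {J : Ideal S} {L : Type u} [AddCommGroup L] [Module R L] [Module S L]
    [IsScalarTower R S L] (hL : ∀ j ∈ J, ∀ x : L, j • x = 0) {s : S} {r : R}
    (hr : s - algebraMap R S r ∈ J) (x : L) : s • x = r • x := by
  rw [← algebraMap_smul S r x, ← sub_eq_zero, ← sub_smul]
  exact hL _ hr x

/-- In an injective `Q` containing `W`, let `P` be a maximal essential extension and `C` maximal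
avoiding `e`. Then `P` embeds in `Q ⧸ C`, itself essential over `e`. Extending `P ⊆ Q` to `Q ⧸ C`
gives a map whose image, by maximality, is in `P`; so `P` is a retract of `Q`. -/
theorem exists_isSimpleHull_extension [IsLocalRing S] (W : Type u) [AddCommGroup W] [Module S W]
    (e : W) (he : e ≠ 0) (hm : ∀ s ∈ maximalIdeal S, s • e = 0)
    (hess : ∀ x : W, x ≠ 0 → ∃ s : S, s • x = e) :
    ∃ (E' : Type u) (_ : AddCommGroup E') (_ : Module S E') (ι : W →ₗ[S] E'),
      Function.Injective ι ∧ IsSimpleHull S E' (ι e) := by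
  let Q := CategoryTheory.Injective.under (ModuleCat.of S W)
  have hQ : Module.Injective S Q := 
    (Module.injective_iff_injective_object S Q).2
      (CategoryTheory.Injective.injective_under (ModuleCat.of S W))
  let i : W →ₗ[S] Q := (CategoryTheory.Injective.ι (ModuleCat.of S W)).hom
  have hi : Function.Injective i :=
    (ModuleCat.mono_iff_injective (CategoryTheory.Injective.ι (ModuleCat.of S W))).1 inferInstance
  have hie : i e ≠ 0 := fun h0 => he (hi (h0.trans (map_zero i).symm))
  obtain ⟨P, hPi, hP⟩ := zorn_le_nonempty₀
    {P : Submodule S Q | ∀ x ∈ P, x ≠ 0 → ∃ s : S, s • x = i e} (by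
      intro c hc hchain y hy
      refine ⟨sSup c, fun x hx hx0 => ?_, fun z hz => le_sSup hz⟩
      obtain ⟨p, hp, hxp⟩ := (Submodule.mem_sSup_of_directed ⟨y, hy⟩ hchain.directedOn).1 hx
      exact hc hp x hxp hx0) (LinearMap.range i) (by
      rintro _ ⟨x, rfl⟩ hx0
      obtain ⟨s, hs⟩ := hess x (by rintro rfl; exact hx0 (map_zero i))
      exact ⟨s, by rw [← map_smul, hs]⟩)
  obtain ⟨C, -, hC⟩ := zorn_le_nonempty₀ {C : Submodule S Q | i e ∉ C} (by
      intro c hc hchain y hy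
      refine ⟨sSup c, fun hx => ?_, fun z hz => le_sSup hz⟩
      obtain ⟨p, hp, hxp⟩ := (Submodule.mem_sSup_of_directed ⟨y, hy⟩ hchain.directedOn).1 hx
      exact hc hp hxp) ⊥ hie
  have hCess : ∀ q : Q ⧸ C, q ≠ 0 → ∃ s : S, s • q = C.mkQ (i e) := by
    intro q hq
    obtain ⟨q, rfl⟩ := C.mkQ_surjective q
    have hqC : q ∉ C := fun hmem => hq ((Submodule.Quotient.mk_eq_zero C).2 hmem)
    have hmem : i e ∈ C ⊔ S ∙ q := by
      by_contra hne
      exact hqC (hC.2 hne le_sup_left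
        (Submodule.mem_sup_right (Submodule.mem_span_singleton_self q)))
    obtain ⟨c, hc, _, hz, hcz⟩ := Submodule.mem_sup.1 hmem
    obtain ⟨s, rfl⟩ := Submodule.mem_span_singleton.1 hz
    refine ⟨s, ?_⟩
    rw [← hcz, map_add, map_smul]
    have : C.mkQ c = 0 := (Submodule.Quotient.mk_eq_zero C).2 hc
    rw [this, zero_add]
  obtain ⟨g, hg⟩ := exists_extend (E := Q) (C.mkQ ∘ₗ P.subtype) (by
    rw [injective_iff_map_eq_zero]
    intro x hx
    by_contra hx0
    obtain ⟨s, hs⟩ := hP.1 x.1 x.2 (fun h0 => hx0 (Subtype.ext h0))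
    refine hC.1 ?_
    rw [← hs]
    exact C.smul_mem s ((Submodule.Quotient.mk_eq_zero C).1 hx)) P.subtype
  have hge : g (C.mkQ (i e)) = i e := hg ⟨i e, hPi ⟨e, rfl⟩⟩
  have hgP : LinearMap.range g ≤ P := by
    refine hP.2 ?_ ?_
    · rintro _ ⟨q, rfl⟩ hq
      obtain ⟨s, hs⟩ := hCess q (by rintro rfl; exact hq (map_zero g))
      exact ⟨s, by rw [← map_smul, hs, hge]⟩
    · intro x hx
      exact ⟨_, hg ⟨x, hx⟩⟩
  let ρ : Q →ₗ[S] P := LinearMap.codRestrict P (g ∘ₗ C.mkQ) fun x => hgP ⟨_, rfl⟩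
  have hρ (x : P) : ρ x = x := Subtype.ext (hg x)
  refine ⟨P, inferInstance, inferInstance,
    LinearMap.codRestrict P i fun x => hPi ⟨x, rfl⟩, fun x y hxy => hi (congrArg Subtype.val hxy),
    ⟨fun X Y _ _ _ _ f hf k => ?_⟩, fun h0 => hie (congrArg Subtype.val h0), fun s hs => ?_,
    fun x hx => ?_⟩
  · obtain ⟨h, hh⟩ := exists_extend (E := Q) f hf (P.subtype ∘ₗ k)
    refine ⟨ρ ∘ₗ h, fun x => ?_⟩
    rw [LinearMap.comp_apply, hh]
    exact hρ (k x)
  · rw [← map_smul, hm s hs, map_zero]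
  · obtain ⟨s, hs⟩ := hP.1 x.1 x.2 fun h0 => hx (Subtype.ext h0)
    exact ⟨s, Subtype.ext hs⟩

/-- Maps from `L` into a hull only see the part killed by `I`, respectively `J`. Building the
`S`-hull `E'` on the `I`-torsion `W` of `E` makes these parts agree, so both duals of `L` coincide.
-/
theorem IsSimpleHull.isMatlisReflexive_of_refl [IsLocalRing R] [IsLocalRing S] {E : Type u}
    [AddCommGroup E] [Module R E] {e : E} (h : IsSimpleHull R E e) (I : Ideal R) (J : Ideal S)
    (hI : J.comap (algebraMap R S) = I) (hJ : ∀ s : S, ∃ r : R, s - algebraMap R S r ∈ J)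
    (hIm : I ≤ maximalIdeal R) (L : Type u) [AddCommGroup L] [Module R L] [Module S L]
    [IsScalarTower R S L] (hIL : ∀ r ∈ I, ∀ x : L, r • x = 0)
    (hJL : ∀ j ∈ J, ∀ x : L, j • x = 0) (hL : Refl R E L) : IsMatlisReflexive S L := by
  have := h.inj
  let W := Submodule.torsionBySet R E (I : Set R)
  have hW {x : E} : x ∈ W ↔ ∀ r ∈ I, r • x = 0 := by
    simp [W, Submodule.mem_torsionBySet_iff]
  obtain ⟨_, _, hJW⟩ := exists_module_of_surjective I J hI hJ W fun r hr x =>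
    Subtype.ext (hW.1 x.2 r hr)
  let eW : W := ⟨e, hW.2 fun r hr => h.smul_eq_zero r (hIm hr)⟩
  have hJm : J ≤ maximalIdeal S := by
    refine le_maximalIdeal fun htop => ?_
    have h1 : (1 : R) ∈ I := by rw [← hI, htop]; trivial
    exact (Ideal.ne_top_iff_one _).1 (maximalIdeal.isMaximal R).ne_top (hIm h1)
  obtain ⟨E', _, _, ι, hι, h'⟩ := exists_isSimpleHull_extension (S := S) W eW
    (fun h0 => h.ne_zero (congrArg Subtype.val h0))
    (by
      intro s hs
      obtain ⟨r, hr⟩ := hJ s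
      rw [smul_eq_of_sub_mem hJW hr]
      refine Subtype.ext (h.smul_eq_zero r ?_)
      rw [mem_maximalIdeal, mem_nonunits_iff]
      intro hu
      have : algebraMap R S r ∈ maximalIdeal S := by
        have := sub_mem hs (hJm hr)
        rwa [sub_sub_cancel] at this
      exact this (hu.map (algebraMap R S)))
    (by
      intro x hx
      obtain ⟨r, hr⟩ := h.ess x.1 fun h0 => hx (Subtype.ext h0)
      exact ⟨algebraMap R S r, by rw [algebraMap_smul]; exact Subtype.ext hr⟩)
  let _ : Module R E' := Module.compHom E' (algebraMap R S)
  have : IsScalarTower R S E' := IsScalarTower.of_algebraMap_smul fun _ _ => rfl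
  obtain ⟨ρ, hρ⟩ := exists_extend (E := E) (ι.restrictScalars R) hι W.subtype
  have hρι (w : W) : ρ (ι w) = w := hρ w
  -- `ρ` is injective on the `J`-torsion of `E'` by essentiality, since `S` acts there through `R`.
  have hρ0 : ∀ x : E', (∀ j ∈ J, j • x = 0) → ρ x = 0 → x = 0 := by
    intro x hx hx0
    by_contra hne
    obtain ⟨s, hs⟩ := h'.ess x hne
    obtain ⟨r, hr⟩ := hJ s
    have hrx : r • x = ι eW := by
      rw [← hs, ← algebraMap_smul S r x, eq_comm, ← sub_eq_zero, ← sub_smul]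
      exact hx _ hr
    have : ρ (r • x) = 0 := by rw [map_smul, hx0, smul_zero]
    rw [hrx, hρι] at this
    exact h.ne_zero this
  have hρinj : ∀ x y : E', (∀ j ∈ J, j • x = 0) → (∀ j ∈ J, j • y = 0) → ρ x = ρ y → x = y := by
    intro x y hx hy hxy
    rw [← sub_eq_zero]
    refine hρ0 _ (fun j hj => by rw [smul_sub, hx j hj, hy j hj, sub_zero]) ?_
    rw [map_sub, hxy, sub_self]
  have hιJ (w : W) : ∀ j ∈ J, j • ι w = 0 := fun j hj => by rw [← map_smul, hJW j hj, map_zero]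
  have hIJ {r : R} (hr : r ∈ I) : algebraMap R S r ∈ J := by rwa [← hI] at hr
  have hLW (ψ : L →ₗ[R] E) (l : L) : ψ l ∈ W :=
    hW.2 fun r hr => by rw [← map_smul, hIL r hr, map_zero]
  let T (ψ : L →ₗ[R] E) : L →ₗ[S] E' :=
    { toFun := fun l => ι ⟨ψ l, hLW ψ l⟩
      map_add' := fun a b => by
        rw [← map_add]
        exact congrArg ι (Subtype.ext (map_add ψ a b))
      map_smul' := fun s l => by
        obtain ⟨r, hr⟩ := hJ s
        rw [RingHom.id_apply, ← map_smul, smul_eq_of_sub_mem hJW hr]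
        refine congrArg ι (Subtype.ext ?_)
        change ψ (s • l) = r • ψ l
        rw [smul_eq_of_sub_mem hJL hr, map_smul] }
  rw [isMatlisReflexive_iff]
  refine ⟨E', _, _, _, h', h'.refl_iff.2 fun Φ => ?_⟩
  let φ : (L →ₗ[R] E) →ₗ[R] E :=
    { toFun := fun ψ => ρ (Φ (T ψ))
      map_add' := fun a b => by
        have : T (a + b) = T a + T b := LinearMap.ext fun l => by
          change ι _ = ι _ + ι _
          rw [← map_add]
          rfl
        rw [this, map_add, map_add]
      map_smul' := fun r a => by
        have : T (r • a) = algebraMap R S r • T a := LinearMap.ext fun l => by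
          change ι _ = algebraMap R S r • ι _
          rw [← map_smul, algebraMap_smul]
          rfl
        rw [this, map_smul, algebraMap_smul, map_smul]
        rfl }
  obtain ⟨x, hx⟩ := h.refl_iff.1 hL φ
  refine ⟨x, fun χ => ?_⟩
  have hχJ (l : L) : ∀ j ∈ J, j • χ l = 0 := fun j hj => by rw [← map_smul, hJL j hj, map_zero]
  have hTχ : T (ρ ∘ₗ χ.restrictScalars R) = χ := LinearMap.ext fun l =>
    hρinj _ _ (hιJ _) (hχJ l) (hρι _)
  refine hρinj _ _ (fun j hj => ?_) (hχJ x) ?_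
  · rw [← map_smul]
    have : j • χ = 0 := LinearMap.ext fun l => hχJ l j hj
    rw [this, map_zero]
  · have := hx (ρ ∘ₗ χ.restrictScalars R)
    change ρ (Φ (T _)) = _ at this
    rw [hTχ] at this
    exact this

end Transfer

theorem IsSimpleHull.isMatlisReflexiveOverCompletion {R : Type u} [CommRing R] [IsLocalRing R]
    [IsNoetherianRing R] {E : Type u} [AddCommGroup E] [Module R E] {e : E}
    (h : IsSimpleHull R E e) (I : Ideal R) (hIm : I ≤ maximalIdeal R)
    (hIr : Refl R E (R ⧸ I)) (L : Type u) [AddCommGroup L] [Module R L]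
    (hIL : ∀ r ∈ I, ∀ x : L, r • x = 0) (hL : Refl R E L) :
    IsMatlisReflexiveOverCompletion R L := by
  obtain ⟨J, hJI, hJle, hJ⟩ := exists_ideal_adicCompletion I (h.isPrecomplete_of_refl hIr _)
  obtain ⟨inst, htower, hJL⟩ := exists_module_of_surjective I J hJI hJ L hIL
  refine ⟨inst, htower, fun inst' htower' => ?_,
    h.isMatlisReflexive_of_refl I J hJI hJ hIm L hIL hJL hL⟩
  -- Any compatible structure kills the extension of `I`, hence `J`, so it is determined by the
  -- action of `R`.
  have hJL' : ∀ j ∈ J, ∀ x : L, inst'.toSMul.smul j x = 0 := by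
    let _ := inst'
    intro j hj x
    change j • x = 0
    have : I.map (algebraMap R (LocalCompletion R)) ≤
        LinearMap.ker (LinearMap.toSpanSingleton (LocalCompletion R) L x) := by
      rw [Ideal.map_le_iff_le_comap]
      intro r hr
      change algebraMap R (LocalCompletion R) r • x = 0
      rw [algebraMap_smul, hIL r hr]
    exact this (hJle hj)
  refine Module.ext' _ _ fun s x => ?_
  obtain ⟨r, hr⟩ := hJ s
  exact (@smul_eq_of_sub_mem R (LocalCompletion R) _ _ _ J L _ _ inst' htower' hJL' s r hr x).trans
    (@smul_eq_of_sub_mem R (LocalCompletion R) _ _ _ J L _ _ inst htower hJL s r hr x).symm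

open IsLocalRing CategoryTheory MonoidalCategory

/-! ### Tor as homology of `M ⊗ P`, with its long exact sequence in `M` -/

section TensorComplex

variable {R : Type u} [CommRing R]

theorem homologyMap_smul {C D : ChainComplex (ModuleCat.{u} R) ℕ} (φ : C ⟶ D) (r : R) (i : ℕ) :
    HomologicalComplex.homologyMap (r • φ) i = r • HomologicalComplex.homologyMap φ i := by
  have h := ShortComplex.homologyMap_smul
    ((HomologicalComplex.shortComplexFunctor (ModuleCat.{u} R) (ComplexShape.down ℕ) i).map φ) r
  exact h

/-- The functor sending `M` to the complex `M ⊗ C`. -/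
noncomputable def tensorComplex (C : ChainComplex (ModuleCat.{u} R) ℕ) :
    ModuleCat.{u} R ⥤ ChainComplex (ModuleCat.{u} R) ℕ where
  obj M := (((tensoringLeft (ModuleCat.{u} R)).obj M).mapHomologicalComplex _).obj C
  map f := (NatTrans.mapHomologicalComplex ((tensoringLeft (ModuleCat.{u} R)).map f) _).app C

instance (C : ChainComplex (ModuleCat.{u} R) ℕ) : (tensorComplex C).Additive where
  map_add {M N f g} := by
    ext i : 1
    exact MonoidalPreadditive.add_whiskerRight f g

instance (C : ChainComplex (ModuleCat.{u} R) ℕ) : (tensorComplex C).Linear R where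
  map_smul {M N} f r := by
    ext i : 1
    exact MonoidalLinear.smul_whiskerRight r f _

/-- The homology of the complex `M ⊗ C`, as a functor of `M`. -/
noncomputable abbrev tensorHomology (C : ChainComplex (ModuleCat.{u} R) ℕ) (i : ℕ) :
    ModuleCat.{u} R ⥤ ModuleCat.{u} R :=
  tensorComplex C ⋙ HomologicalComplex.homologyFunctor _ _ i

theorem tensorHomology_map_smul (C : ChainComplex (ModuleCat.{u} R) ℕ) (i : ℕ)
    {M N : ModuleCat.{u} R} (f : M ⟶ N) (r : R) :
    (tensorHomology C i).map (r • f) = r • (tensorHomology C i).map f := by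
  change HomologicalComplex.homologyMap ((tensorComplex C).map (r • f)) i = _
  rw [Functor.map_smul]
  exact homologyMap_smul _ r i

theorem tensorComplex_shortExact (C : ChainComplex (ModuleCat.{u} R) ℕ)
    [∀ n, Projective (C.X n)] {S : ShortComplex (ModuleCat.{u} R)} (hS : S.ShortExact) :
    (S.map (tensorComplex C)).ShortExact := by
  refine HomologicalComplex.shortExact_of_degreewise_shortExact _ fun n => ?_
  have : Module.Projective R (C.X n) :=
    (IsProjective.iff_projective (R := R) (C.X n)).2 (inferInstanceAs (Projective (C.X n)))
  have hflat : Module.Flat R (C.X n) := inferInstance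
  have hinj := hS.moduleCat_injective_f
  have hsurj := hS.moduleCat_surjective_g
  refine ModuleCat.shortComplex_shortExact _ ?_ ?_ ?_
  · exact (ShortComplex.ShortExact.moduleCat_exact_iff_function_exact _).1
      (Module.Flat.rTensor_shortComplex_exact (C.X n) S hS.exact)
  · exact Module.Flat.rTensor_preserves_injective_linearMap S.f.hom hinj
  · exact LinearMap.rTensor_surjective (C.X n) hsurj

section LES

variable (C : ChainComplex (ModuleCat.{u} R) ℕ)
variable {X Y Z : Type u} [AddCommGroup X] [Module R X] [AddCommGroup Y] [Module R Y]
  [AddCommGroup Z] [Module R Z] (f : X →ₗ[R] Y) (g : Y →ₗ[R] Z)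

/-- The map induced by a linear map on the homology of the tensor complexes. -/
noncomputable def tensorHomologyMap (i : ℕ) :
    (tensorHomology C i).obj (ModuleCat.of R X) →ₗ[R] (tensorHomology C i).obj (ModuleCat.of R Y) :=
  ((tensorHomology C i).map (ModuleCat.ofHom f)).hom

theorem tensorHomologyMap_comp (i : ℕ) (x) :
    tensorHomologyMap C g i (tensorHomologyMap C f i x) = tensorHomologyMap C (g ∘ₗ f) i x := by
  simp only [tensorHomologyMap, ModuleCat.ofHom_comp, Functor.map_comp]
  rfl

theorem tensorHomologyMap_smul_id (i : ℕ) (r : R) (x) :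
    tensorHomologyMap C (r • (LinearMap.id : X →ₗ[R] X)) i x = r • x := by
  have h1 : ModuleCat.ofHom (r • (LinearMap.id : X →ₗ[R] X)) = r • 𝟙 (ModuleCat.of R X) := rfl
  rw [tensorHomologyMap, h1, tensorHomology_map_smul, CategoryTheory.Functor.map_id]
  rfl

variable {f g}

theorem tensorHomologyMap_exact [∀ n, Projective (C.X n)] (hf : Function.Injective f) (hg : Function.Surjective g)
    (hfg : Function.Exact f g) (i : ℕ) :
    Function.Exact (tensorHomologyMap C f i) (tensorHomologyMap C g i) := by
  have hS := ModuleCat.shortComplex_shortExact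
    (ModuleCat.shortComplexOfCompEqZero f g hfg.linearMap_comp_eq_zero) hfg hf hg
  exact (ShortComplex.ShortExact.moduleCat_exact_iff_function_exact _).1
    ((tensorComplex_shortExact C hS).homology_exact₂ i)

theorem exists_connecting [∀ n, Projective (C.X n)] (hf : Function.Injective f) (hg : Function.Surjective g)
    (hfg : Function.Exact f g) (i : ℕ) :
    ∃ δ : (tensorHomology C (i + 1)).obj (ModuleCat.of R Z) →ₗ[R]
        (tensorHomology C i).obj (ModuleCat.of R X),
      Function.Exact (tensorHomologyMap C g (i + 1)) δ ∧
      Function.Exact δ (tensorHomologyMap C f i) := by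
  have hS := ModuleCat.shortComplex_shortExact
    (ModuleCat.shortComplexOfCompEqZero f g hfg.linearMap_comp_eq_zero) hfg hf hg
  have hT := tensorComplex_shortExact C hS
  refine ⟨(hT.δ (i + 1) i rfl).hom, ?_, ?_⟩
  · exact (ShortComplex.ShortExact.moduleCat_exact_iff_function_exact _).1
      (hT.homology_exact₃ (i + 1) i rfl)
  · exact (ShortComplex.ShortExact.moduleCat_exact_iff_function_exact _).1
      (hT.homology_exact₁ (i + 1) i rfl)

end LES

theorem subsingleton_tensorHomology_of_flat {Y : ModuleCat.{u} R} (P : ProjectiveResolution Y)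
    (X : Type u) [AddCommGroup X] [Module R X] [Module.Flat R X] (i : ℕ) :
    Subsingleton ((tensorHomology P.complex (i + 1)).obj (ModuleCat.of R X)) := by
  have h1 := P.complex_exactAt_succ i
  rw [HomologicalComplex.exactAt_iff' _ (i + 2) (i + 1) i (by simp) (by simp)] at h1
  rw [ShortComplex.ShortExact.moduleCat_exact_iff_function_exact] at h1
  have h2 : ((tensorComplex P.complex).obj (ModuleCat.of R X)).ExactAt (i + 1) := by
    rw [HomologicalComplex.exactAt_iff' _ (i + 2) (i + 1) i (by simp) (by simp),
      ShortComplex.ShortExact.moduleCat_exact_iff_function_exact]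
    exact Module.Flat.lTensor_exact X h1
  exact ModuleCat.subsingleton_of_isZero h2.isZero_homology

/-- The homology of `M ⊗ P` is the torsion module `Tor`. -/
noncomputable def tensorHomologyIso {Y : Type u} [AddCommGroup Y] [Module R Y]
    (P : ProjectiveResolution (ModuleCat.of R Y)) (M : Type u) [AddCommGroup M] [Module R M]
    (i : ℕ) : TorModule R i M Y ≅ (tensorHomology P.complex i).obj (ModuleCat.of R M) :=
  P.isoLeftDerivedObj ((tensoringLeft (ModuleCat.{u} R)).obj (ModuleCat.of R M)) i

/-- In degree zero `Tor` is the tensor product. -/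
noncomputable def torZeroIso (M Y : Type u) [AddCommGroup M] [Module R M] [AddCommGroup Y]
    [Module R Y] : TorModule R 0 M Y ≅ ModuleCat.of R M ⊗ ModuleCat.of R Y :=
  ((tensoringLeft (ModuleCat.{u} R)).obj (ModuleCat.of R M)).leftDerivedZeroIsoSelf.app
    (ModuleCat.of R Y)

/-- Multiplication by `r` and zero on a projective resolution both lift the zero map of `Y`, so they
agree on homology. -/
theorem smul_torModule_eq_zero {Y : Type u} [AddCommGroup Y] [Module R Y] {r : R}
    (hr : ∀ y : Y, r • y = 0) (M : Type u) [AddCommGroup M] [Module R M] (i : ℕ)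
    (x : TorModule R i M Y) : r • x = 0 := by
  let P := projectiveResolution (ModuleCat.of R Y)
  let F := (tensoringLeft (ModuleCat.{u} R)).obj (ModuleCat.of R M)
  have hπ : (r • 𝟙 P.complex) ≫ P.π = 0 := by
    rw [Linear.smul_comp, Category.id_comp]
    refine HomologicalComplex.to_single_hom_ext ?_
    ext y
    exact hr _
  have h1 := Functor.leftDerived_map_eq F i (0 : ModuleCat.of R Y ⟶ ModuleCat.of R Y)
    (r • 𝟙 P.complex) (by rw [hπ, Functor.map_zero, Limits.comp_zero])
  have h2 := Functor.leftDerived_map_eq F i (0 : ModuleCat.of R Y ⟶ ModuleCat.of R Y)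
    (0 : P.complex ⟶ P.complex) (by rw [Functor.map_zero, Limits.comp_zero, Limits.zero_comp])
  have h4 : (F.mapHomologicalComplex (ComplexShape.down ℕ) ⋙
      HomologicalComplex.homologyFunctor _ _ i).map (0 : P.complex ⟶ P.complex) = 0 :=
    Functor.map_zero _ _ _
  rw [h4, Limits.zero_comp, Limits.comp_zero] at h2
  have h3 : (F.mapHomologicalComplex (ComplexShape.down ℕ) ⋙
      HomologicalComplex.homologyFunctor _ _ i).map (r • 𝟙 P.complex) = r • 𝟙 _ := by
    change HomologicalComplex.homologyMap ((F.mapHomologicalComplex _).map (r • 𝟙 _)) i = _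
    rw [Functor.map_smul, CategoryTheory.Functor.map_id, homologyMap_smul,
      HomologicalComplex.homologyMap_id]
    rfl
  rw [h2, h3, Linear.smul_comp, Linear.comp_smul] at h1
  have h5 := LinearMap.congr_fun (congrArg ModuleCat.Hom.hom h1) x
  change 0 = r • (P.isoLeftDerivedObj F i).inv.hom ((P.isoLeftDerivedObj F i).hom.hom x) at h5
  have h6 : (P.isoLeftDerivedObj F i).inv.hom ((P.isoLeftDerivedObj F i).hom.hom x) = x :=
    LinearMap.congr_fun (congrArg ModuleCat.Hom.hom (P.isoLeftDerivedObj F i).hom_inv_id) x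
  rw [h6] at h5
  exact h5.symm

end TensorComplex

/-! ### Torsion for the maximal ideal and artinian modules -/

section Local

variable {R : Type u} [CommRing R] [IsLocalRing R]

theorem isMaxTorsion_of_injective {X Y : Type u} [AddCommGroup X] [Module R X] [AddCommGroup Y]
    [Module R Y] (f : X →ₗ[R] Y) (hf : Function.Injective f) (hY : IsMaxTorsion R Y) :
    IsMaxTorsion R X := fun x => by
  obtain ⟨n, hn⟩ := hY (f x)
  exact ⟨n, fun r hr => hf (by rw [map_smul, hn r hr, map_zero])⟩

theorem isMaxTorsion_of_surjective {X Y : Type u} [AddCommGroup X] [Module R X] [AddCommGroup Y]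
    [Module R Y] (f : X →ₗ[R] Y) (hf : Function.Surjective f) (hX : IsMaxTorsion R X) :
    IsMaxTorsion R Y := fun y => by
  obtain ⟨x, rfl⟩ := hf y
  obtain ⟨n, hn⟩ := hX x
  exact ⟨n, fun r hr => by rw [← map_smul, hn r hr, map_zero]⟩

theorem isMaxTorsion_tensorProduct (X Y : Type u) [AddCommGroup X] [Module R X] [AddCommGroup Y]
    [Module R Y] (hX : IsMaxTorsion R X) : IsMaxTorsion R (TensorProduct R X Y) := fun t => by
  induction t with
  | zero => exact ⟨0, fun r _ => smul_zero r⟩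
  | tmul x y =>
    obtain ⟨n, hn⟩ := hX x
    exact ⟨n, fun r hr => by rw [TensorProduct.smul_tmul', hn r hr, TensorProduct.zero_tmul]⟩
  | add a b ha hb =>
    obtain ⟨n, hn⟩ := ha
    obtain ⟨k, hk⟩ := hb
    refine ⟨max n k, fun r hr => ?_⟩
    rw [smul_add, hn r (Ideal.pow_le_pow_right (le_max_left n k) hr),
      hk r (Ideal.pow_le_pow_right (le_max_right n k) hr), add_zero]

theorem isMaxTorsion_tensorHomology (C : ChainComplex (ModuleCat.{u} R) ℕ) (X : Type u)
    [AddCommGroup X] [Module R X] (hX : IsMaxTorsion R X) (i : ℕ) :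
    IsMaxTorsion R ((tensorHomology C i).obj (ModuleCat.of R X)) := by
  let K := (tensorComplex C).obj (ModuleCat.of R X)
  have h1 : IsMaxTorsion R (K.X i) := isMaxTorsion_tensorProduct X (C.X i) hX
  have h2 : IsMaxTorsion R (K.cycles i) := isMaxTorsion_of_injective (K.iCycles i).hom
    ((ModuleCat.mono_iff_injective _).1 inferInstance) h1
  exact isMaxTorsion_of_surjective (K.homologyπ i).hom
    ((ModuleCat.epi_iff_surjective _).1 inferInstance) h2

theorem isMaxTorsion_of_isArtinian [IsNoetherianRing R] (X : Type u) [AddCommGroup X]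
    [Module R X] [IsArtinian R X] : IsMaxTorsion R X := fun x => by
  obtain ⟨n, hn⟩ := IsArtinian.monotone_stabilizes (R := R) (M := X)
    ⟨fun n => OrderDual.toDual (maximalIdeal R ^ n • (R ∙ x)), fun a b hab =>
      OrderDual.toDual_le_toDual.2 (Submodule.smul_mono_left (Ideal.pow_le_pow_right hab))⟩
  have hn1 : maximalIdeal R ^ n • (R ∙ x) = maximalIdeal R ^ (n + 1) • (R ∙ x) :=
    hn (n + 1) (Nat.le_succ n)
  have hbot : maximalIdeal R ^ n • (R ∙ x) = ⊥ := by
    refine Submodule.eq_bot_of_le_smul_of_le_jacobson_bot (maximalIdeal R) _ ?_ ?_ ?_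
    · exact Submodule.FG.smul (IsNoetherian.noetherian _) (Submodule.fg_span_singleton x)
    · rw [← mul_smul, ← pow_succ', ← hn1]
    · exact (IsLocalRing.jacobson_eq_maximalIdeal ⊥ bot_ne_top).ge
  refine ⟨n, fun r hr => ?_⟩
  rw [← Submodule.mem_bot R, ← hbot]
  exact Submodule.smul_mem_smul hr (Submodule.mem_span_singleton_self x)

theorem finite_of_isArtinian_of_smul_eq_zero (X : Type u) [AddCommGroup X] [Module R X]
    [IsArtinian R X] (hm : ∀ r ∈ maximalIdeal R, ∀ x : X, r • x = 0) : Module.Finite R X := by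
  have ht : Module.IsTorsionBySet R X (maximalIdeal R : Set R) := fun x r => hm r r.2 x
  let _ : Module (ResidueField R) X := ht.module
  have : IsScalarTower R (ResidueField R) X := ht.isScalarTower
  have : IsArtinian (ResidueField R) X := isArtinian_of_tower R inferInstance
  have : Module.Finite (ResidueField R) X :=
    IsSemiprimaryRing.finite_of_isArtinian (ResidueField R) (ResidueField R) X
  exact Module.Finite.trans (ResidueField R) X

end Local

/-! ### Reflexivity of Tor for finite, artinian and mini-max modules -/

section Main

variable {R : Type u} [CommRing R] [IsLocalRing R] {E : Type u} [AddCommGroup E]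
  [Module R E] {e : E} {Y : Type u} [AddCommGroup Y] [Module R Y]

theorem IsSimpleHull.refl_ker_comp (h : IsSimpleHull R E e) {A B C : Type u} [AddCommGroup A]
    [Module R A] [AddCommGroup B] [Module R B] [AddCommGroup C] [Module R C] (f : A →ₗ[R] B)
    (g : B →ₗ[R] C) (hf : Refl R E (LinearMap.ker f)) (hg : Refl R E (LinearMap.ker g)) :
    Refl R E (LinearMap.ker (g ∘ₗ f)) := by
  refine h.refl_of_exact (Submodule.inclusion (LinearMap.ker_le_ker_comp f g))
    (f.restrict (p := LinearMap.ker (g ∘ₗ f)) (q := LinearMap.ker g) fun x hx => hx) ?_ hf hg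
  rintro ⟨x, hx⟩
  constructor
  · intro h0
    exact ⟨⟨x, congrArg Subtype.val h0⟩, rfl⟩
  · rintro ⟨⟨y, hy⟩, hxy⟩
    have : y = x := congrArg Subtype.val hxy
    subst this
    exact Subtype.ext hy

theorem IsSimpleHull.refl_tensorProduct (h : IsSimpleHull R E e) (hY : Refl R E Y) (M : Type u)
    [AddCommGroup M] [Module R M] [Module.Finite R M] : Refl R E (TensorProduct R M Y) := by
  obtain ⟨n, t, ht⟩ := Module.Finite.exists_fin (R := R) (M := M)
  refine h.refl_of_surjective (X := Fin n → Y)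
    (LinearMap.lsum R (fun _ => Y) R fun i => TensorProduct.mk R M Y (t i)) ?_ (h.refl_pi hY n)
  rw [← LinearMap.range_eq_top, eq_top_iff, ← TensorProduct.span_tmul_eq_top, Submodule.span_le]
  rintro _ ⟨x, y, rfl⟩
  obtain ⟨c, rfl⟩ := (Submodule.mem_span_range_iff_exists_fun R).1
    (ht ▸ Submodule.mem_top : x ∈ Submodule.span R (Set.range t))
  refine ⟨fun i => c i • y, ?_⟩
  rw [LinearMap.lsum_apply, LinearMap.sum_apply, TensorProduct.sum_tmul]
  refine Finset.sum_congr rfl fun i _ => ?_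
  exact (TensorProduct.smul_tmul _ _ _).symm

theorem IsSimpleHull.refl_tensorHomology_of_finite [IsNoetherianRing R] (h : IsSimpleHull R E e)
    (P : ProjectiveResolution (ModuleCat.of R Y)) (hY : Refl R E Y) (i : ℕ) (M : Type u)
    [AddCommGroup M] [Module R M] [Module.Finite R M] :
    Refl R E ((tensorHomology P.complex i).obj (ModuleCat.of R M)) := by
  induction i generalizing M with
  | zero =>
    exact h.refl_equiv ((torZeroIso M Y).symm ≪≫ tensorHomologyIso P M 0).toLinearEquiv
      (h.refl_tensorProduct hY M)
  | succ i ih =>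
    obtain ⟨n, f, hf⟩ := Module.Finite.exists_fin' R M
    obtain ⟨δ, hδ, -⟩ := exists_connecting P.complex (LinearMap.ker f).subtype_injective hf
      (LinearMap.exact_subtype_ker_map f) i
    have := subsingleton_tensorHomology_of_flat P (Fin n → R) i
    exact h.refl_of_exact _ δ hδ h.refl_of_subsingleton (ih (LinearMap.ker f))

/-- `G` holds generators of the maximal ideal not yet required to kill `A`. The kernel and cokernel
of `x ∈ G` on `A` need one generator fewer. The cokernel enters in degree `i + 1`, so the degree
must vary in the induction. -/
theorem IsSimpleHull.refl_tensorHomology_of_isArtinian [IsNoetherianRing R]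
    (h : IsSimpleHull R E e) (P : ProjectiveResolution (ModuleCat.of R Y)) (hY : Refl R E Y)
    {I : Ideal R} (hI : ∀ r ∈ I, ∀ y : Y, r • y = 0) (hIr : Refl R E (R ⧸ I)) (G : Finset R)
    (hG : ∀ x ∈ G, x ∈ maximalIdeal R) (i : ℕ) (A : Type u) [AddCommGroup A] [Module R A]
    [IsArtinian R A] (hA : maximalIdeal R ≤ Ideal.span G ⊔ Module.annihilator R A) :
    Refl R E ((tensorHomology P.complex i).obj (ModuleCat.of R A)) := by
  classical
  induction G using Finset.induction_on generalizing A i with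
  | empty =>
    have : Module.Finite R A := finite_of_isArtinian_of_smul_eq_zero A fun r hr x => by
      have := hA hr
      rw [Finset.coe_empty, Ideal.span_empty, bot_sup_eq] at this
      exact Module.mem_annihilator.1 this x
    exact h.refl_tensorHomology_of_finite P hY i A
  | insert x G _ ih =>
    have ih' := ih fun y hy => hG y (Finset.mem_insert_of_mem hy)
    have hxm : x ∈ maximalIdeal R := hG x (Finset.mem_insert_self x G)
    have hann (B : Type u) [AddCommGroup B] [Module R B] (hx : ∀ b : B, x • b = 0)
        (hAB : Module.annihilator R A ≤ Module.annihilator R B) :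
        maximalIdeal R ≤ Ideal.span G ⊔ Module.annihilator R B := by
      refine hA.trans (sup_le ?_ (hAB.trans le_sup_right))
      rw [Ideal.span_le, Finset.coe_insert, Set.insert_subset_iff]
      exact ⟨Ideal.mem_sup_right (Module.mem_annihilator.2 hx),
        fun y hy => Ideal.mem_sup_left (Ideal.subset_span hy)⟩
    let μ : A →ₗ[R] A := x • LinearMap.id
    have h1 := ih' i (LinearMap.ker μ) (hann _ (fun b => Subtype.ext b.2)
      (LinearMap.annihilator_le_of_injective _ (LinearMap.ker μ).subtype_injective))
    have h2 := ih' (i + 1) (A ⧸ LinearMap.range μ) (hann _ (fun b => by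
      obtain ⟨a, rfl⟩ := Submodule.mkQ_surjective _ b
      rw [← map_smul]
      exact (Submodule.Quotient.mk_eq_zero _).2 ⟨a, rfl⟩)
      (LinearMap.annihilator_le_of_surjective _ (LinearMap.range μ).mkQ_surjective))
    have hker1 : Refl R E (LinearMap.ker (tensorHomologyMap P.complex μ.rangeRestrict i)) := by
      have hex := tensorHomologyMap_exact P.complex (LinearMap.ker μ).subtype_injective
        μ.surjective_rangeRestrict (by
          rw [LinearMap.exact_iff, Submodule.range_subtype, LinearMap.ker_rangeRestrict]) i
      rw [LinearMap.exact_iff.1 hex]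
      exact h.refl_of_surjective _ (LinearMap.surjective_rangeRestrict _) h1
    have hker2 : Refl R E
        (LinearMap.ker (tensorHomologyMap P.complex (LinearMap.range μ).subtype i)) := by
      obtain ⟨δ, -, hδ⟩ := exists_connecting P.complex (LinearMap.range μ).subtype_injective
        (LinearMap.range μ).mkQ_surjective (LinearMap.exact_subtype_mkQ _) i
      rw [LinearMap.exact_iff.1 hδ]
      exact h.refl_of_surjective _ (LinearMap.surjective_rangeRestrict _) h2
    -- Multiplication by `x` on `A` factors through its image, so its kernel on Tor is an extension
    -- built from the two kernels.
    have hker := h.refl_ker_comp _ _ hker1 hker2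
    refine h.refl_of_isMaxTorsion (isMaxTorsion_tensorHomology P.complex A
      (isMaxTorsion_of_isArtinian A) i) ?_ (I := I) ?_ hIr
    · refine h.refl_of_injective (Submodule.inclusion fun t ht => ?_)
        (Submodule.inclusion_injective _) hker
      rw [LinearMap.mem_ker, LinearMap.comp_apply, tensorHomologyMap_comp]
      have : (LinearMap.range μ).subtype ∘ₗ μ.rangeRestrict = μ := rfl
      rw [this, tensorHomologyMap_smul_id]
      exact (Submodule.mem_torsionBySet_iff _ _).1 ht ⟨x, hxm⟩
    · intro r hr t
      have := smul_torModule_eq_zero (hI r hr) A i ((tensorHomologyIso P A i).inv.hom t)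
      rw [← map_smul] at this
      exact (tensorHomologyIso P A i).symm.toLinearEquiv.injective
        (this.trans (map_zero _).symm)

theorem IsSimpleHull.refl_torModule [IsNoetherianRing R] (h : IsSimpleHull R E e)
    (hY : Refl R E Y) {I : Ideal R} (hI : ∀ r ∈ I, ∀ y : Y, r • y = 0)
    (hIr : Refl R E (R ⧸ I)) (M : Type u) [AddCommGroup M] [Module R M] (hM : IsMiniMax R M)
    (i : ℕ) : Refl R E (TorModule R i M Y) := by
  obtain ⟨N, _, _⟩ := hM
  let P := projectiveResolution (ModuleCat.of R Y)
  refine h.refl_equiv (tensorHomologyIso P M i).symm.toLinearEquiv ?_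
  obtain ⟨G, hG⟩ := (IsNoetherian.noetherian (maximalIdeal R) : (maximalIdeal R).FG)
  refine h.refl_of_exact _ _ (tensorHomologyMap_exact P.complex N.subtype_injective
    N.mkQ_surjective (LinearMap.exact_subtype_mkQ N) i)
    (h.refl_tensorHomology_of_finite P hY i N)
    (h.refl_tensorHomology_of_isArtinian P hY hI hIr G
      (fun x hx => hG ▸ Submodule.subset_span hx) i (M ⧸ N) ?_)
  exact hG.ge.trans le_sup_left

end Main

end MatlisDuality

theorem mainTheorem9 (R : Type u) [CommRing R] [IsLocalRing R] [IsNoetherianRing R]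
    (M M' : Type u) [AddCommGroup M] [Module R M] [AddCommGroup M'] [Module R M']
    (hM : IsMiniMax R M) (hM' : IsMatlisReflexive R M') (i : ℕ) :
    IsMatlisReflexive R (TorModule R i M M') ∧
      IsMatlisReflexiveOverCompletion R (TorModule R i M M') := by
  obtain ⟨E, _, _, e, h, hr⟩ := (MatlisDuality.isMatlisReflexive_iff M').1 hM'
  obtain ⟨I, hIm, hI, hIr⟩ := h.exists_refl_quotient_ideal hr
  have hT := h.refl_torModule hr hI hIr M hM i
  exact ⟨(MatlisDuality.isMatlisReflexive_iff _).2 ⟨E, _, _, e, h, hT⟩,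
    h.isMatlisReflexiveOverCompletion I hIm hIr _
      (fun r hr => MatlisDuality.smul_torModule_eq_zero (hI r hr) M i) hT⟩
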